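/- Let $n\ge 2$, $1<p<\frac{n}{n-1}$, $m>p$ and $\lambda>0$. Consider the energy $$J(v,D)=\int_{D}\big\{F(\nabla v,v,x)+W(v,x)\big\}\,dx,$$ where $F:\mathbb{R}^n\times\mathbb{R}\times\mathbb{R}^n\to\mathbb{R}$ and $W:\mathbb{R}\times\mathbb{R}^n\to\mathbb{R}$ satisfy, for all $\xi,x\in\mathbb{R}^n$ and $\tau\in[-1,1]$: - (A) $\lambda^{-1}|\xi|^{p}\le F(\xi,\tau,x)\le\lambda|\xi|^{p}$; - (B) $\lambda^{-1}(1-\tau^{2})^{m}\le W(\tau,x)\le\lambda(1-\tau^{2})^{m}$; - (C) for each fixed $x$, $\tau\mapsto W(\tau,x)$ is nondecreasing on $[-1,0]$ and nonincreasing on $[0,1]$. (No regularity of $F$ and $W$ is assumed; if the nonnegative integrand is not measurable, the integral is understood as a lower integral.) For an open set $\Omega\subseteq\mathbb{R}^n$ (for example $\Omega=\mathbb{R}^n$), a function $u\in W^{1,p}_{\mathrm{loc}}(\Omega,[-1,1])$ is called a minimizer in $\Omega$ if $J(u,D)\le J(v,D)$ for every bounded open $D$ with $\overline D\subseteq\Omega$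 and every $v\in W^{1,p}_{\mathrm{loc}}(\Omega,[-1,1])$ with $v=u$ a.e. in $\Omega\setminus D$. Write $u(x)=c$ for a point value in the representative-independent sense $\lim_{r\to0^+}\frac{1}{|B_r(x)|}\int_{B_r(x)}u\,dy=c$; for a continuous $u$ this is the usual value. Then for every $h\in(0,1)$ there is a radius $\rho>0$, depending only on $h,n,p,m,\lambda$, such that for all $F,W$ satisfying (A), (B), (C), every open $\Omega\supseteq B_\rho=B_\rho(0)$, and every minimizer $u$ in $\Omega$ with $u(0)=0$, one has $$\max_{B_\rho}u\ \ge\ 1-h,$$ in the sense that $u(x)=c$ for some $x\in B_\rho$ and some $c\ge 1-h$. -/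

import Mathlib

open MeasureTheory Set Filter Topology
open scoped ContDiff

/-- `G` is a weak gradient of `v` in the open set `Ω`, tested against smooth functions with compact
support in `Ω`. (The local integrability of `v` and `G` is part of `MemW1pLoc` below.) -/
def IsWeakGradient {n : ℕ} (Ω : Set (EuclideanSpace ℝ (Fin n)))
    (v : EuclideanSpace ℝ (Fin n) → ℝ)
    (G : EuclideanSpace ℝ (Fin n) → EuclideanSpace ℝ (Fin n)) : Prop :=
  ∀ φ : EuclideanSpace ℝ (Fin n) → ℝ, ContDiff ℝ ∞ φ → HasCompactSupport φ → tsupport φ ⊆ Ω →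
    ∫ x in Ω, v x • gradient φ x = - ∫ x in Ω, φ x • G x

/-- `v` belongs to `W^{1,p}_loc(Ω)`, and `G` is its weak gradient there. -/
structure MemW1pLoc {n : ℕ} (p : ℝ) (Ω : Set (EuclideanSpace ℝ (Fin n)))
    (v : EuclideanSpace ℝ (Fin n) → ℝ)
    (G : EuclideanSpace ℝ (Fin n) → EuclideanSpace ℝ (Fin n)) : Prop where
  memLp : ∀ K : Set (EuclideanSpace ℝ (Fin n)), IsCompact K → K ⊆ Ω →
    MemLp v (ENNReal.ofReal p) (volume.restrict K)
  memLp_gradient : ∀ K : Set (EuclideanSpace ℝ (Fin n)), IsCompact K → K ⊆ Ω →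
    MemLp G (ENNReal.ofReal p) (volume.restrict K)
  isWeakGradient : IsWeakGradient Ω v G

/-- `v` belongs to `W^{1,p}_loc(Ω, [-1,1])`, and `G` is its weak gradient there. -/
def Admissible {n : ℕ} (p : ℝ) (Ω : Set (EuclideanSpace ℝ (Fin n)))
    (v : EuclideanSpace ℝ (Fin n) → ℝ)
    (G : EuclideanSpace ℝ (Fin n) → EuclideanSpace ℝ (Fin n)) : Prop :=
  MemW1pLoc p Ω v G ∧ ∀ᵐ x ∂(volume.restrict Ω), v x ∈ Icc (-1 : ℝ) 1

/-- The Ginzburg-Landau energy `J(v, D) = ∫_D (F(∇v, v, x) + W(v, x)) dx`, where `G = ∇v`.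
The integrand is nonnegative for the `F`, `W`, `v` considered, and the energy may be `∞`. -/
noncomputable def energy {n : ℕ}
    (F : EuclideanSpace ℝ (Fin n) → ℝ → EuclideanSpace ℝ (Fin n) → ℝ)
    (W : ℝ → EuclideanSpace ℝ (Fin n) → ℝ)
    (v : EuclideanSpace ℝ (Fin n) → ℝ)
    (G : EuclideanSpace ℝ (Fin n) → EuclideanSpace ℝ (Fin n))
    (D : Set (EuclideanSpace ℝ (Fin n))) : ENNReal :=
  ∫⁻ x in D, ENNReal.ofReal (F (G x) (v x) x + W (v x) x)

/-- `u` is a minimizer of the energy in the open set `Ω`: it is in `W^{1,p}_loc(Ω, [-1,1])`, and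
`J(u, D) ≤ J(v, D)` for every bounded open `D ⊂⊂ Ω` and every `v` in `W^{1,p}_loc(Ω, [-1,1])`
that agrees with `u` (almost everywhere) in `Ω \ D`. -/
def IsMinimizer {n : ℕ} (p : ℝ)
    (F : EuclideanSpace ℝ (Fin n) → ℝ → EuclideanSpace ℝ (Fin n) → ℝ)
    (W : ℝ → EuclideanSpace ℝ (Fin n) → ℝ)
    (Ω : Set (EuclideanSpace ℝ (Fin n)))
    (u : EuclideanSpace ℝ (Fin n) → ℝ) : Prop :=
  ∃ G : EuclideanSpace ℝ (Fin n) → EuclideanSpace ℝ (Fin n), Admissible p Ω u G ∧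
    ∀ D : Set (EuclideanSpace ℝ (Fin n)), IsOpen D → Bornology.IsBounded D → closure D ⊆ Ω →
      ∀ (v : EuclideanSpace ℝ (Fin n) → ℝ)
        (H : EuclideanSpace ℝ (Fin n) → EuclideanSpace ℝ (Fin n)), Admissible p Ω v H →
        (∀ᵐ x ∂(volume.restrict (Ω \ D)), v x = u x) →
        energy F W u G D ≤ energy F W v H D

/-- Assumption (A): `F` has `p`-growth, for all `τ ∈ [-1,1]`. -/
def AssumptionA {n : ℕ} (p lam : ℝ)
    (F : EuclideanSpace ℝ (Fin n) → ℝ → EuclideanSpace ℝ (Fin n) → ℝ) : Prop :=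
  ∀ (ξ : EuclideanSpace ℝ (Fin n)) (τ : ℝ) (x : EuclideanSpace ℝ (Fin n)), τ ∈ Icc (-1 : ℝ) 1 →
    lam⁻¹ * ‖ξ‖ ^ p ≤ F ξ τ x ∧ F ξ τ x ≤ lam * ‖ξ‖ ^ p

/-- Assumption (B): `W` is comparable with `(1 - τ²)^m` for all `τ ∈ [-1,1]`. -/
def AssumptionB {n : ℕ} (m lam : ℝ) (W : ℝ → EuclideanSpace ℝ (Fin n) → ℝ) : Prop :=
  ∀ (τ : ℝ) (x : EuclideanSpace ℝ (Fin n)), τ ∈ Icc (-1 : ℝ) 1 →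
    lam⁻¹ * (1 - τ ^ 2) ^ m ≤ W τ x ∧ W τ x ≤ lam * (1 - τ ^ 2) ^ m

/-- Assumption (C): `W` is (weakly) increasing in `τ` on `[-1,0]`, (weakly) decreasing on `[0,1]`. -/
def AssumptionC {n : ℕ} (W : ℝ → EuclideanSpace ℝ (Fin n) → ℝ) : Prop :=
  ∀ x : EuclideanSpace ℝ (Fin n),
    MonotoneOn (fun τ => W τ x) (Icc (-1 : ℝ) 0) ∧ AntitoneOn (fun τ => W τ x) (Icc (0 : ℝ) 1)

/-- The pointwise value of a Sobolev function, independent of the choice of a representative: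
`u(x) = c` in the sense that the averages of `u` over the balls `B_r(x)` tend to `c` as `r → 0`.
If `u` has a representative that is continuous at `x`, then `c` is the value of that
representative at `x`. -/
def HasPreciseValue {n : ℕ} (u : EuclideanSpace ℝ (Fin n) → ℝ)
    (x : EuclideanSpace ℝ (Fin n)) (c : ℝ) : Prop :=
  Tendsto (fun r : ℝ => ⨍ y in Metric.ball x r, u y) (𝓝[>] 0) (𝓝 c)

/-! ### Mollification and approximation of weak gradients. -/

section WeakGradientCalculus

variable {n : ℕ}

/-! Suppose that `u` stays below `1 - h` in a large ball. Then `u` can no longer use the well `1`,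
and every point where `u` is away from `-1` costs a fixed amount of potential energy. Pulling `u`
down towards a level `l` near `-1` removes that cost in the bulk and creates a new one only in a
boundary annulus, so minimality forces `u` to be close to `-1` in a smaller ball. This is
incompatible with the value `0` at the centre.

The competitor is `u - η (u - l)₊` with a radial cutoff `η`. It equals `l`, with zero gradient, on
the inner superlevel set, and it coincides with `u` where `u ≤ l`. Monotonicity of `W` on `[-1, 0]`
controls the potential up to a level `σ ≤ 0`; above `σ` there is a gain `c` inside and a loss of at
most `lam` in the annulus. Hole filling absorbs the annulus terms and gives the Caccioppoli
inequality `exists_caccioppoli_const`: the integral of `‖∇u‖ ^ p + 1_{u > σ}` over `{u > l} ∩ B_s`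
is at most `K (t - s)⁻ᵖ` times the volume of `{u > l} ∩ B_t`.

This inequality is used twice. With `l = -1`, where `W` vanishes, and `σ = -1 + κ / 2`, it shows
that `{u > -1 + κ / 2}` has relative density of order `R⁻ᵖ` in `B_{2R}`, hence as small as desired
for large `R`. With `σ = 0` and levels in `[-1, -1 + κ]`, it combines with the Sobolev embedding of
`W^{1,1}` into `L^{n/(n-1)}` to give the superlinear estimate `exists_volume_superlevel_le`. De
Giorgi's iteration (`exists_pos_tendsto_zero_of_superlinear`) then improves small density to zero
measure: `u ≤ -1 + κ < 0` a.e. in `B_R` (`exists_radius_forall_ae_le`), so the averages of `u`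
around the centre cannot tend to `0`.

As `F` and `W` need not be measurable, energies are compared as lower integrals, and these are split
only over measurable sets or with a measurable second summand. -/

theorem gradient_mul_apply {f g : EuclideanSpace ℝ (Fin n) → ℝ} {x : EuclideanSpace ℝ (Fin n)}
    (hf : DifferentiableAt ℝ f x) (hg : DifferentiableAt ℝ g x) :
    gradient (fun y => f y * g y) x = f x • gradient g x + g x • gradient f x := by
  simp only [gradient]
  rw [fderiv_fun_mul hf hg]
  simp

theorem ContDiff.continuous_gradient {f : EuclideanSpace ℝ (Fin n) → ℝ} (hf : ContDiff ℝ 1 f) :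
    Continuous (gradient f) :=
  (InnerProductSpace.toDual ℝ (EuclideanSpace ℝ (Fin n))).symm.continuous.comp
    (hf.continuous_fderiv one_ne_zero)

theorem norm_gradient (f : EuclideanSpace ℝ (Fin n) → ℝ) (x : EuclideanSpace ℝ (Fin n)) :
    ‖gradient f x‖ = ‖fderiv ℝ f x‖ := by
  simp [gradient]

theorem gradient_eq_zero_of_notMem_tsupport {f : EuclideanSpace ℝ (Fin n) → ℝ}
    {x : EuclideanSpace ℝ (Fin n)} (hx : x ∉ tsupport f) : gradient f x = 0 := by
  simp [gradient, fderiv_of_notMem_tsupport (𝕜 := ℝ) hx]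

theorem HasCompactSupport.gradient {f : EuclideanSpace ℝ (Fin n) → ℝ} (hf : HasCompactSupport f) :
    HasCompactSupport (gradient f) :=
  hf.of_isClosed_subset (isClosed_tsupport _) <| closure_minimal
    (fun x hx => by
      by_contra h
      exact hx (gradient_eq_zero_of_notMem_tsupport h)) (isClosed_tsupport _)

/-- Integration by parts for `C¹` functions, one of them with compact support. -/
theorem integral_smul_gradient_eq_neg {g φ : EuclideanSpace ℝ (Fin n) → ℝ} (hg : ContDiff ℝ 1 g)
    (hφ : ContDiff ℝ 1 φ) (hφc : HasCompactSupport φ) :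
    ∫ x, g x • gradient φ x = - ∫ x, φ x • gradient g x := by
  have i1 : Integrable (fun x => g x • gradient φ x) :=
    (hg.continuous.smul hφ.continuous_gradient).integrable_of_hasCompactSupport
      hφc.gradient.smul_left
  have i2 : Integrable (fun x => φ x • gradient g x) :=
    (hφ.continuous.smul hg.continuous_gradient).integrable_of_hasCompactSupport hφc.smul_right
  have i3 : Integrable (fun x => g x * φ x) :=
    (hg.continuous.mul hφ.continuous).integrable_of_hasCompactSupport hφc.mul_left
  refine ext_inner_left ℝ fun v => ?_
  rw [inner_neg_right, ← integral_inner i1, ← integral_inner i2]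
  have j1 := i1.const_inner (𝕜 := ℝ) v
  have j2 := i2.const_inner (𝕜 := ℝ) v
  simp only [inner_smul_right, inner_gradient_right, conj_trivial] at j1 j2 ⊢
  rw [integral_mul_fderiv_eq_neg_fderiv_mul_of_integrable (by simpa only [mul_comm] using j2) j1 i3
    (fun x _ => hg.differentiable one_ne_zero x) (fun x _ => hφ.differentiable one_ne_zero x)]
  simp only [mul_comm]

/-- The convolution of a Sobolev function with a smooth kernel has the mollified weak gradient as
its gradient. -/
theorem gradient_convolution_of_isWeakGradient {ψ f : EuclideanSpace ℝ (Fin n) → ℝ}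
    {G : EuclideanSpace ℝ (Fin n) → EuclideanSpace ℝ (Fin n)}
    (hψ : ContDiff ℝ ∞ ψ) (hψc : HasCompactSupport ψ) (hf : Integrable f)
    (h : IsWeakGradient univ f G) :
    gradient (convolution ψ f (ContinuousLinearMap.lsmul ℝ ℝ) volume)
      = convolution ψ G (ContinuousLinearMap.lsmul ℝ ℝ) volume := by
  have hψ1 : ContDiff ℝ 1 ψ := hψ.of_le (by exact_mod_cast le_top)
  ext1 x
  have hd := hψc.hasFDerivAt_convolution_left (ContinuousLinearMap.lsmul ℝ ℝ) hψ1
    hf.locallyIntegrable (μ := volume) x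
  have hgr : ∀ y, gradient (fun y => ψ (x - y)) y = - gradient ψ (x - y) := by
    intro y
    have h1 : HasFDerivAt (fun y => ψ (x - y))
        ((fderiv ℝ ψ (x - y)).comp (-ContinuousLinearMap.id ℝ (EuclideanSpace ℝ (Fin n)))) y :=
      ((hψ1.differentiable one_ne_zero (x - y)).hasFDerivAt).comp y
        ((hasFDerivAt_id y).const_sub x)
    rw [gradient, h1.fderiv]
    simp only [gradient, ContinuousLinearMap.comp_neg, ContinuousLinearMap.comp_id, map_neg]
  -- The test function is the reflected translate of the kernel. Its gradient carries a minus sign,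
  -- which cancels the one in the definition of the weak gradient.
  have key := h (fun y => ψ (x - y)) (hψ.comp (contDiff_const.sub contDiff_id))
    (hψc.comp_homeomorph (Homeomorph.subLeft x)) (subset_univ _)
  simp only [setIntegral_univ, hgr, smul_neg, integral_neg, neg_inj] at key
  rw [convolution_eq_swap]
  simp only [ContinuousLinearMap.lsmul_apply]
  rw [← key]
  have hcg : Continuous fun y => gradient ψ (x - y) :=
    hψ1.continuous_gradient.comp (continuous_const.sub continuous_id)
  have hcs : HasCompactSupport fun y => gradient ψ (x - y) :=
    hψc.gradient.comp_homeomorph (Homeomorph.subLeft x)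
  obtain ⟨C, hC⟩ := hcg.bounded_above_of_compact_support hcs
  have hi : Integrable fun y => f y • gradient ψ (x - y) := by
    refine (hf.norm.mul_const C).mono' (hf.aestronglyMeasurable.smul hcg.aestronglyMeasurable) ?_
    filter_upwards with y
    rw [norm_smul]
    exact mul_le_mul_of_nonneg_left (hC y) (norm_nonneg _)
  refine ext_inner_left ℝ fun v => ?_
  have hex := (hψc.fderiv ℝ).convolutionExists_left
    (ContinuousLinearMap.precompL (EuclideanSpace ℝ (Fin n)) (ContinuousLinearMap.lsmul ℝ ℝ))
    (hψ1.continuous_fderiv one_ne_zero) hf.locallyIntegrable x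
  rw [← integral_inner hi, inner_gradient_right, hd.fderiv, conj_trivial, convolution_eq_swap,
    ContinuousLinearMap.integral_apply hex.integrable_swap]
  refine integral_congr_ae (Eventually.of_forall fun y => ?_)
  simp [inner_smul_right, inner_gradient_right, mul_comm]

/-- Young's inequality in `L¹` for a normalized bump function. -/
theorem lintegral_enorm_convolution_bump_le {E' : Type*} [NormedAddCommGroup E'] [NormedSpace ℝ E']
    (φ : ContDiffBump (0 : EuclideanSpace ℝ (Fin n))) {g : EuclideanSpace ℝ (Fin n) → E'}
    (hg : AEStronglyMeasurable g) :
    ∫⁻ x, ‖convolution (φ.normed volume) g (ContinuousLinearMap.lsmul ℝ ℝ) volume x‖ₑ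
      ≤ ∫⁻ x, ‖g x‖ₑ := by
  have hm := AEStronglyMeasurable.convolution_integrand (ContinuousLinearMap.lsmul ℝ ℝ)
    (μ := volume) (ν := volume)
    (φ.continuous_normed (μ := volume)).aestronglyMeasurable hg
  calc ∫⁻ x, ‖convolution (φ.normed volume) g (ContinuousLinearMap.lsmul ℝ ℝ) volume x‖ₑ
      ≤ ∫⁻ x, ∫⁻ t, ‖(φ.normed volume t) • g (x - t)‖ₑ :=
        lintegral_mono fun x => enorm_integral_le_lintegral_enorm _
    _ = ∫⁻ t, ∫⁻ x, ‖(φ.normed volume t) • g (x - t)‖ₑ := by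
        refine lintegral_lintegral_swap ?_
        exact hm.enorm
    _ = ∫⁻ t, ‖φ.normed volume t‖ₑ * ∫⁻ x, ‖g x‖ₑ := by
        refine lintegral_congr fun t => ?_
        simp only [enorm_smul]
        rw [lintegral_const_mul' _ _ enorm_ne_top, lintegral_sub_right_eq_self (fun x => ‖g x‖ₑ) t]
    _ = ∫⁻ x, ‖g x‖ₑ := by
        rw [lintegral_mul_const _ (φ.continuous_normed (μ := volume)).measurable.enorm]
        have : ∫⁻ t, ‖φ.normed volume t‖ₑ = 1 := by
          rw [← ofReal_integral_norm_eq_lintegral_enorm φ.integrable_normed]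
          simp only [Real.norm_eq_abs, abs_of_nonneg (φ.nonneg_normed _)]
          rw [φ.integral_normed, ENNReal.ofReal_one]
        rw [this, one_mul]

/-- Almost everywhere convergence, together with an upper bound of the norms by the norm of the
limit, implies convergence in `L¹`. -/
theorem tendsto_lintegral_enorm_sub_of_le {α E' : Type*} [MeasurableSpace α] {μ : Measure α}
    [NormedAddCommGroup E'] {f : ℕ → α → E'} {g : α → E'}
    (hf : ∀ k, AEStronglyMeasurable (f k) μ) (hg : Integrable g μ)
    (hle : ∀ k, ∫⁻ x, ‖f k x‖ₑ ∂μ ≤ ∫⁻ x, ‖g x‖ₑ ∂μ)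
    (hlim : ∀ᵐ x ∂μ, Tendsto (fun k => f k x) atTop (𝓝 (g x))) :
    Tendsto (fun k => ∫⁻ x, ‖f k x - g x‖ₑ ∂μ) atTop (𝓝 0) := by
  set I := ∫⁻ x, ‖g x‖ₑ ∂μ with hI
  have hIfin : I ≠ ⊤ := hg.hasFiniteIntegral.ne
  have hfi : ∀ k, Integrable (f k) μ := fun k => ⟨hf k, (hle k).trans_lt hIfin.lt_top⟩
  have hdfin : ∀ k, ∫⁻ x, ‖f k x - g x‖ₑ ∂μ ≠ ⊤ := fun k => ((hfi k).sub hg).hasFiniteIntegral.ne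
  have hpt : ∀ k x, ‖f k x - g x‖ₑ ≤ ‖f k x‖ₑ + ‖g x‖ₑ := fun k x => enorm_sub_le
  -- Fatou's lemma is applied to `‖f k‖ + ‖g‖ - ‖f k - g‖ ≥ 0`, which tends to `2 ‖g‖` a.e. The
  -- bound on the norms then leaves no room for the integral of `‖f k - g‖`.
  have hsum : ∀ k, ∫⁻ x, (‖f k x‖ₑ + ‖g x‖ₑ - ‖f k x - g x‖ₑ) ∂μ
      ≤ 2 * I - ∫⁻ x, ‖f k x - g x‖ₑ ∂μ := by
    intro k
    rw [lintegral_sub' (g := fun x => ‖f k x - g x‖ₑ)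
      ((hf k).sub hg.aestronglyMeasurable).enorm (hdfin k)
      (Eventually.of_forall (hpt k)), lintegral_add_left' (hf k).enorm, two_mul]
    gcongr
    exact hle k
  have hfatou : 2 * I ≤ liminf (fun k => 2 * I - ∫⁻ x, ‖f k x - g x‖ₑ ∂μ) atTop := by
    calc 2 * I = ∫⁻ x, 2 * ‖g x‖ₑ ∂μ := (lintegral_const_mul' _ _ (by simp)).symm
      _ ≤ ∫⁻ x, liminf (fun k => ‖f k x‖ₑ + ‖g x‖ₑ - ‖f k x - g x‖ₑ) atTop ∂μ := by
          refine lintegral_mono_ae ?_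
          filter_upwards [hlim] with x hx
          have h1 : Tendsto (fun k => ‖f k x - g x‖ₑ) atTop (𝓝 0) := by
            simpa using (hx.sub_const (g x)).enorm
          have h2 := ENNReal.Tendsto.sub (hx.enorm.add_const ‖g x‖ₑ) h1 (Or.inr (by simp))
          rw [h2.liminf_eq, tsub_zero, two_mul]
      _ ≤ liminf (fun k => ∫⁻ x, (‖f k x‖ₑ + ‖g x‖ₑ - ‖f k x - g x‖ₑ) ∂μ) atTop :=
          lintegral_liminf_le' fun k => ((hf k).enorm.add hg.aestronglyMeasurable.enorm).sub
            ((hf k).sub hg.aestronglyMeasurable).enorm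
      _ ≤ _ := liminf_le_liminf (Eventually.of_forall hsum)
  have h2I : 2 * I ≠ ⊤ := ENNReal.mul_ne_top (by simp) hIfin
  have hle2 : ∀ k, ∫⁻ x, ‖f k x - g x‖ₑ ∂μ ≤ 2 * I := fun k => by
    calc _ ≤ ∫⁻ x, (‖f k x‖ₑ + ‖g x‖ₑ) ∂μ := lintegral_mono (hpt k)
      _ ≤ 2 * I := by
        rw [lintegral_add_left' (hf k).enorm, two_mul]
        gcongr
        exact hle k
  rw [ENNReal.tendsto_nhds_zero]
  intro ε hε
  -- Subtraction is truncated, so `2 * I - ε < 2 * I` requires `I ≠ 0`.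
  rcases eq_or_ne I 0 with h0 | h0
  · exact Eventually.of_forall fun k => by
      have := hle2 k
      rw [h0, mul_zero] at this
      exact this.trans bot_le
  have hlt : 2 * I - ε < liminf (fun k => 2 * I - ∫⁻ x, ‖f k x - g x‖ₑ ∂μ) atTop :=
    (ENNReal.sub_lt_self h2I (by simpa using h0) hε.ne').trans_le hfatou
  filter_upwards [eventually_lt_of_lt_liminf hlt] with k hk
  by_contra hcon
  exact absurd hk (not_lt.mpr (tsub_le_tsub_left (not_le.mp hcon).le _))

/-- Simultaneous approximation of a Sobolev function on the whole space and of its weak gradient by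
smooth functions. -/
theorem exists_smooth_approx_of_isWeakGradient {f : EuclideanSpace ℝ (Fin n) → ℝ}
    {G : EuclideanSpace ℝ (Fin n) → EuclideanSpace ℝ (Fin n)} (hf : Integrable f)
    (hG : Integrable G) (h : IsWeakGradient univ f G) :
    ∃ F : ℕ → EuclideanSpace ℝ (Fin n) → ℝ, (∀ k, ContDiff ℝ ∞ (F k)) ∧
      (HasCompactSupport f → ∀ k, HasCompactSupport (F k)) ∧
      (∀ᵐ x, Tendsto (fun k => F k x) atTop (𝓝 (f x))) ∧
      (∀ᵐ x, Tendsto (fun k => gradient (F k) x) atTop (𝓝 (G x))) ∧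
      (∀ k, ∫⁻ x, ‖F k x‖ₑ ≤ ∫⁻ x, ‖f x‖ₑ) ∧
      (∀ k, ∫⁻ x, ‖gradient (F k) x‖ₑ ≤ ∫⁻ x, ‖G x‖ₑ) := by
  -- The ratio of the outer to the inner radius stays equal to `2`; with a bounded ratio the
  -- mollifications converge at a.e. point.
  let φ : ℕ → ContDiffBump (0 : EuclideanSpace ℝ (Fin n)) := fun k =>
    { rIn := 1 / ((k : ℝ) + 1)
      rOut := 2 * (1 / ((k : ℝ) + 1))
      rIn_pos := by positivity
      rIn_lt_rOut := by
        have : (0 : ℝ) < 1 / ((k : ℝ) + 1) := by positivity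
        linarith }
  have hφ : Tendsto (fun k => (φ k).rOut) atTop (𝓝 0) := by
    simpa [φ] using tendsto_one_div_add_atTop_nhds_zero_nat.const_mul (2 : ℝ)
  have hφ' : ∀ᶠ k in atTop, (φ k).rOut ≤ 2 * (φ k).rIn := Eventually.of_forall fun k => le_rfl
  have hgr := fun k => gradient_convolution_of_isWeakGradient
    ((φ k).contDiff_normed (μ := volume)) (φ k).hasCompactSupport_normed hf h
  refine ⟨fun k => convolution ((φ k).normed volume) f (ContinuousLinearMap.lsmul ℝ ℝ) volume,
    fun k => ?_, fun hc k => ?_, ?_, ?_, fun k => ?_, fun k => ?_⟩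
  · exact (φ k).hasCompactSupport_normed.contDiff_convolution_left _ (φ k).contDiff_normed
      hf.locallyIntegrable
  · exact (φ k).hasCompactSupport_normed.convolution _ hc
  · exact ContDiffBump.ae_convolution_tendsto_right_of_locallyIntegrable hφ hφ'
      hf.locallyIntegrable
  · simp only [hgr]
    exact ContDiffBump.ae_convolution_tendsto_right_of_locallyIntegrable hφ hφ'
      hG.locallyIntegrable
  · exact lintegral_enorm_convolution_bump_le _ hf.aestronglyMeasurable
  · simp only [hgr]
    exact lintegral_enorm_convolution_bump_le _ hG.aestronglyMeasurable

end WeakGradientCalculus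

/-! ### Chain rule, truncation, Sobolev inequality and product rule for weak gradients. -/

section SobolevCalculus

variable {n : ℕ}

theorem gradient_comp_apply {θ : ℝ → ℝ} {f : EuclideanSpace ℝ (Fin n) → ℝ}
    {x : EuclideanSpace ℝ (Fin n)} (hθ : DifferentiableAt ℝ θ (f x))
    (hf : DifferentiableAt ℝ f x) :
    gradient (fun y => θ (f y)) x = deriv θ (f x) • gradient f x := by
  have h : HasFDerivAt (fun y => θ (f y)) (deriv θ (f x) • fderiv ℝ f x) x :=
    hθ.hasDerivAt.comp_hasFDerivAt x hf.hasFDerivAt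
  rw [gradient, h.fderiv, map_smulₛₗ]
  simp [gradient]

theorem norm_deriv_comp_smul_le {θ : ℝ → ℝ} (hθ1 : ∀ s, ‖deriv θ s‖ ≤ 1) {c C s : ℝ}
    (hc : ‖c‖ ≤ C) (v : EuclideanSpace ℝ (Fin n)) : ‖c • (deriv θ s • v)‖ ≤ C * ‖v‖ := by
  rw [norm_smul, norm_smul]
  refine mul_le_mul hc ?_ (by positivity) ((norm_nonneg c).trans hc)
  exact mul_le_of_le_one_left (norm_nonneg v) (hθ1 _)

/-- The chain rule for weak gradients, for a `C¹` function with bounded derivative. -/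
theorem IsWeakGradient.comp_contDiff {f : EuclideanSpace ℝ (Fin n) → ℝ}
    {G : EuclideanSpace ℝ (Fin n) → EuclideanSpace ℝ (Fin n)} (h : IsWeakGradient univ f G)
    (hf : Integrable f) (hG : Integrable G) {θ : ℝ → ℝ} (hθ : ContDiff ℝ 1 θ)
    (hθ1 : ∀ s, ‖deriv θ s‖ ≤ 1) :
    IsWeakGradient univ (fun x => θ (f x)) (fun x => deriv θ (f x) • G x) := by
  intro φ hφ hφc _
  simp only [Measure.restrict_univ]
  have hφ1 : ContDiff ℝ 1 φ := hφ.of_le (by exact_mod_cast le_top)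
  obtain ⟨F, hFs, -, hFl, hFgl, hFle, hFgle⟩ := exists_smooth_approx_of_isWeakGradient hf hG h
  have hFs1 : ∀ k, ContDiff ℝ 1 (F k) := fun k => (hFs k).of_le (by exact_mod_cast le_top)
  obtain ⟨C, hC⟩ := hφ1.continuous_gradient.bounded_above_of_compact_support hφc.gradient
  obtain ⟨M, hM⟩ := hφ1.continuous.bounded_above_of_compact_support hφc
  have hθd : Continuous (deriv θ) := hθ.continuous_deriv le_rfl
  have hlip : ∀ a b, ‖θ a - θ b‖ ≤ ‖a - b‖ := fun a b => by
    simpa using Convex.norm_image_sub_le_of_norm_deriv_le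
      (fun x _ => hθ.differentiable one_ne_zero x) (fun x _ => hθ1 x) convex_univ
      (mem_univ b) (mem_univ a)
  have hFL := tendsto_lintegral_enorm_sub_of_le
    (fun k => (hFs k).continuous.aestronglyMeasurable) hf hFle hFl
  have hGL := tendsto_lintegral_enorm_sub_of_le
    (fun k => (hFs1 k).continuous_gradient.aestronglyMeasurable) hG hFgle hFgl
  have hgi : ∀ k, Integrable (gradient (F k)) := fun k =>
    ⟨(hFs1 k).continuous_gradient.aestronglyMeasurable,
      (hFgle k).trans_lt hG.hasFiniteIntegral⟩
  have hLint : Integrable fun x => θ (f x) • gradient φ x := by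
    have hb : Integrable fun x => |θ 0| * ‖gradient φ x‖ + C * ‖f x‖ :=
      ((hφ1.continuous_gradient.integrable_of_hasCompactSupport hφc.gradient).norm.const_mul
        _).add (hf.norm.const_mul C)
    refine hb.mono' ((hθ.continuous.comp_aestronglyMeasurable hf.aestronglyMeasurable).smul
      hφ1.continuous_gradient.aestronglyMeasurable) (Eventually.of_forall fun x => ?_)
    rw [norm_smul]
    have h1 : ‖θ (f x)‖ ≤ |θ 0| + ‖f x‖ := by
      have := hlip (f x) 0
      rw [sub_zero] at this
      calc ‖θ (f x)‖ = ‖θ 0 + (θ (f x) - θ 0)‖ := by rw [add_sub_cancel]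
        _ ≤ |θ 0| + ‖f x‖ := (norm_add_le _ _).trans (add_le_add le_rfl this)
    nlinarith [norm_nonneg (f x), hC x, norm_nonneg (gradient φ x)]
  have hleft : Tendsto (fun k => ∫ x, θ (F k x) • gradient φ x) atTop
      (𝓝 (∫ x, θ (f x) • gradient φ x)) := by
    refine tendsto_integral_of_L1 _ hLint.aestronglyMeasurable (Eventually.of_forall fun k =>
      ((hθ.continuous.comp (hFs k).continuous).smul
        hφ1.continuous_gradient).integrable_of_hasCompactSupport hφc.gradient.smul_left) ?_
    have hb := ENNReal.Tendsto.mul_const hFL (Or.inr (ENNReal.ofReal_ne_top (r := C)))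
    rw [zero_mul] at hb
    refine tendsto_of_tendsto_of_tendsto_of_le_of_le tendsto_const_nhds hb
      (fun _ => bot_le) fun k => ?_
    rw [← lintegral_mul_const' _ _ ENNReal.ofReal_ne_top]
    refine lintegral_mono fun x => ?_
    rw [← sub_smul, enorm_smul]
    refine mul_le_mul' (enorm_le_iff_norm_le.mpr (hlip _ _)) ?_
    rw [← ofReal_norm]
    exact ENNReal.ofReal_le_ofReal (hC x)
  -- The right side is passed to the limit in two pieces. `θ'(F k)` converges only a.e. and needs
  -- the fixed dominating function `M ‖G‖`; the gradients converge in `L¹` and need only that `θ'`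
  -- is bounded. Hence `G` is inserted in place of `gradient (F k)` first, and the difference is
  -- estimated separately in `hR2`.
  have hR1 : Tendsto (fun k => ∫ x, φ x • (deriv θ (F k x) • G x)) atTop
      (𝓝 (∫ x, φ x • (deriv θ (f x) • G x))) := by
    refine tendsto_integral_of_dominated_convergence (fun x => M * ‖G x‖)
      (fun k => hφ1.continuous.aestronglyMeasurable.smul
        ((hθd.comp (hFs k).continuous).aestronglyMeasurable.smul hG.aestronglyMeasurable))
      (hG.norm.const_mul M)
      (fun k => Eventually.of_forall fun x => norm_deriv_comp_smul_le hθ1 (hM x) _) ?_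
    filter_upwards [hFl] with x hx
    exact (((hθd.tendsto _).comp hx).smul_const _).const_smul _
  have hi2 : ∀ k, Integrable fun x => φ x • (deriv θ (F k x) • G x) := fun k =>
    (hG.norm.const_mul M).mono' (hφ1.continuous.aestronglyMeasurable.smul
      ((hθd.comp (hFs k).continuous).aestronglyMeasurable.smul hG.aestronglyMeasurable))
      (Eventually.of_forall fun x => norm_deriv_comp_smul_le hθ1 (hM x) _)
  have hi3 : ∀ k, Integrable fun x => φ x • (deriv θ (F k x) • gradient (F k) x) := fun k =>
    ((hgi k).norm.const_mul M).mono' (hφ1.continuous.aestronglyMeasurable.smul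
      ((hθd.comp (hFs k).continuous).aestronglyMeasurable.smul (hgi k).aestronglyMeasurable))
      (Eventually.of_forall fun x => norm_deriv_comp_smul_le hθ1 (hM x) _)
  have hR2 : Tendsto (fun k => ∫ x, (φ x • (deriv θ (F k x) • gradient (F k) x)
      - φ x • (deriv θ (F k x) • G x))) atTop (𝓝 0) := by
    have : (0 : EuclideanSpace ℝ (Fin n))
        = ∫ _ : EuclideanSpace ℝ (Fin n), (0 : EuclideanSpace ℝ (Fin n)) := by simp
    rw [this]
    refine tendsto_integral_of_L1 _ aestronglyMeasurable_const
      (Eventually.of_forall fun k => (hi3 k).sub (hi2 k)) ?_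
    have hb := ENNReal.Tendsto.const_mul hGL (Or.inr (ENNReal.ofReal_ne_top (r := M)))
    rw [mul_zero] at hb
    refine tendsto_of_tendsto_of_tendsto_of_le_of_le tendsto_const_nhds hb
      (fun _ => bot_le) fun k => ?_
    rw [← lintegral_const_mul' _ _ ENNReal.ofReal_ne_top]
    refine lintegral_mono fun x => ?_
    rw [sub_zero, ← smul_sub, ← smul_sub, ← ofReal_norm, ← ofReal_norm,
      ← ENNReal.ofReal_mul ((norm_nonneg _).trans (hM x))]
    exact ENNReal.ofReal_le_ofReal (norm_deriv_comp_smul_le hθ1 (hM x) _)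
  have hright : Tendsto (fun k => - ∫ x, φ x • (deriv θ (F k x) • gradient (F k) x)) atTop
      (𝓝 (- ∫ x, φ x • (deriv θ (f x) • G x))) := by
    have := (hR2.add hR1).neg
    rw [zero_add] at this
    refine this.congr fun k => ?_
    rw [integral_sub (hi3 k) (hi2 k), sub_add_cancel]
  refine tendsto_nhds_unique hleft (hright.congr fun k => ?_)
  refine Eq.trans ?_
    (integral_smul_gradient_eq_neg (g := fun x => θ (F k x)) (hθ.comp (hFs1 k)) hφ1 hφc).symm
  congr 1
  refine integral_congr_ae (Eventually.of_forall fun x => ?_)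
  beta_reduce
  rw [gradient_comp_apply (hθ.differentiable one_ne_zero _)
    ((hFs1 k).differentiable one_ne_zero x)]

/-- Squaring removes the kink of the positive part at `0`; this is what makes `smoothPosPart` of
class `C¹`. -/
theorem hasDerivAt_max_zero_sq (s : ℝ) :
    HasDerivAt (fun t : ℝ => (max t 0) ^ 2) (2 * max s 0) s := by
  rcases lt_trichotomy s 0 with hs | rfl | hs
  · rw [max_eq_right hs.le, mul_zero]
    refine (hasDerivAt_const s (0 : ℝ)).congr_of_eventuallyEq ?_
    filter_upwards [gt_mem_nhds hs] with t ht
    rw [max_eq_right (le_of_lt ht)]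
    simp
  · rw [max_self, mul_zero, hasDerivAt_iff_isLittleO_nhds_zero]
    have h1 : (fun t : ℝ => t ^ 2) =o[𝓝 0] fun t : ℝ => t := by
      simpa using Asymptotics.isLittleO_pow_id (𝕜 := ℝ) (n := 2) one_lt_two
    refine Asymptotics.IsBigO.trans_isLittleO ?_ h1
    refine Asymptotics.isBigO_of_le _ fun t => ?_
    simp only [zero_add, max_self, smul_zero, sub_zero, norm_pow, Real.norm_eq_abs]
    norm_num
    rcases le_total t 0 with ht | ht
    · simp [max_eq_right ht, sq_nonneg]
    · simp [max_eq_left ht]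
  · rw [max_eq_left hs.le]
    have h2 : HasDerivAt (fun t : ℝ => t ^ 2) (2 * s) s := by simpa using hasDerivAt_pow 2 s
    refine h2.congr_of_eventuallyEq ?_
    filter_upwards [lt_mem_nhds hs] with t ht
    rw [max_eq_left (le_of_lt ht)]

/-- A `C¹` approximation of the positive part. -/
noncomputable def smoothPosPart (ε s : ℝ) : ℝ := √((max s 0) ^ 2 + ε ^ 2) - ε

theorem hasDerivAt_smoothPosPart {ε : ℝ} (hε : 0 < ε) (s : ℝ) :
    HasDerivAt (smoothPosPart ε) (max s 0 / √((max s 0) ^ 2 + ε ^ 2)) s := by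
  have h := (((hasDerivAt_max_zero_sq s).add_const (ε ^ 2)).sqrt (by positivity)).sub_const ε
  have h2 : 2 * max s 0 / (2 * √((max s 0) ^ 2 + ε ^ 2)) = max s 0 / √((max s 0) ^ 2 + ε ^ 2) :=
    mul_div_mul_left _ _ two_ne_zero
  rw [← h2]
  exact h

theorem contDiff_smoothPosPart {ε : ℝ} (hε : 0 < ε) : ContDiff ℝ 1 (smoothPosPart ε) := by
  rw [contDiff_one_iff_deriv]
  refine ⟨fun s => (hasDerivAt_smoothPosPart hε s).differentiableAt, ?_⟩
  have : deriv (smoothPosPart ε) = fun s => max s 0 / √((max s 0) ^ 2 + ε ^ 2) :=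
    funext fun s => (hasDerivAt_smoothPosPart hε s).deriv
  rw [this]
  refine Continuous.div (by fun_prop) (by fun_prop) fun s => ?_
  positivity

theorem norm_deriv_smoothPosPart_le {ε : ℝ} (hε : 0 < ε) (s : ℝ) :
    ‖deriv (smoothPosPart ε) s‖ ≤ 1 := by
  rw [(hasDerivAt_smoothPosPart hε s).deriv, Real.norm_eq_abs,
    abs_of_nonneg (by positivity), div_le_one (by positivity)]
  exact Real.le_sqrt_of_sq_le (by nlinarith)

theorem norm_smoothPosPart_le {ε : ℝ} (hε : 0 < ε) (s : ℝ) : ‖smoothPosPart ε s‖ ≤ ‖s‖ := by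
  have h0 : 0 ≤ max s 0 := le_max_right _ _
  have hm : max s 0 ≤ |s| := max_le (le_abs_self s) (abs_nonneg s)
  have h1 : ε ≤ √((max s 0) ^ 2 + ε ^ 2) := Real.le_sqrt_of_sq_le (by nlinarith)
  have h2 : √((max s 0) ^ 2 + ε ^ 2) ≤ max s 0 + ε :=
    Real.sqrt_le_iff.mpr ⟨by linarith, by nlinarith⟩
  rw [Real.norm_eq_abs, Real.norm_eq_abs, smoothPosPart, abs_of_nonneg (by linarith)]
  linarith

theorem tendsto_smoothPosPart (s : ℝ) :
    Tendsto (fun ε => smoothPosPart ε s) (𝓝 0) (𝓝 (max s 0)) := by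
  have h : Continuous fun ε => smoothPosPart ε s := by unfold smoothPosPart; fun_prop
  have := h.tendsto 0
  simpa [smoothPosPart, Real.sqrt_sq (le_max_right s 0)] using this

/-- For `s ≤ 0` the derivative vanishes for every `ε`, including at the kink `s = 0`. The chain rule
for the truncation therefore comes with the indicator of the strict superlevel set. -/
theorem tendsto_deriv_smoothPosPart (s : ℝ) :
    Tendsto (fun k : ℕ => deriv (smoothPosPart (1 / ((k : ℝ) + 1))) s) atTop
      (𝓝 (if 0 < s then 1 else 0)) := by
  have hd : ∀ k : ℕ, deriv (smoothPosPart (1 / ((k : ℝ) + 1))) s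
      = max s 0 / √((max s 0) ^ 2 + (1 / ((k : ℝ) + 1)) ^ 2) := fun k =>
    (hasDerivAt_smoothPosPart (by positivity) s).deriv
  simp only [hd]
  split_ifs with hs
  · have hc : Tendsto (fun ε : ℝ => max s 0 / √((max s 0) ^ 2 + ε ^ 2)) (𝓝 0)
        (𝓝 (max s 0 / √((max s 0) ^ 2 + 0 ^ 2))) := by
      refine ContinuousAt.tendsto (f := fun ε : ℝ => max s 0 / √((max s 0) ^ 2 + ε ^ 2)) ?_
      refine ContinuousAt.div (by fun_prop) (by fun_prop) ?_
      rw [max_eq_left hs.le]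
      positivity
    have h1 : max s 0 / √((max s 0) ^ 2 + 0 ^ 2) = 1 := by
      rw [max_eq_left hs.le, zero_pow two_ne_zero, add_zero, Real.sqrt_sq hs.le, div_self hs.ne']
    rw [h1] at hc
    exact hc.comp tendsto_one_div_add_atTop_nhds_zero_nat
  · rw [max_eq_right (not_lt.mp hs)]
    simp

/-- The chain rule for the truncation `f ↦ (f - l)₊`. -/
theorem IsWeakGradient.posPart_sub_const {f : EuclideanSpace ℝ (Fin n) → ℝ}
    {G : EuclideanSpace ℝ (Fin n) → EuclideanSpace ℝ (Fin n)} (h : IsWeakGradient univ f G)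
    (hf : Integrable f) (hG : Integrable G) (l : ℝ) :
    IsWeakGradient univ (fun x => max (f x - l) 0)
      (fun x => (if l < f x then (1 : ℝ) else 0) • G x) := by
  intro φ hφ hφc hs
  have hφ1 : ContDiff ℝ 1 φ := hφ.of_le (by exact_mod_cast le_top)
  let ε : ℕ → ℝ := fun k => 1 / ((k : ℝ) + 1)
  have hε : ∀ k, 0 < ε k := fun k => by positivity
  have hε0 : Tendsto ε atTop (𝓝 0) := tendsto_one_div_add_atTop_nhds_zero_nat
  let θ : ℕ → ℝ → ℝ := fun k s => smoothPosPart (ε k) (s - l)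
  have hθ : ∀ k, ContDiff ℝ 1 (θ k) := fun k =>
    (contDiff_smoothPosPart (hε k)).comp (contDiff_id.sub contDiff_const)
  have hθd : ∀ k s, deriv (θ k) s = deriv (smoothPosPart (ε k)) (s - l) := fun k s =>
    deriv_comp_sub_const ..
  have hθ1 : ∀ k s, ‖deriv (θ k) s‖ ≤ 1 := fun k s => by
    rw [hθd]
    exact norm_deriv_smoothPosPart_le (hε k) _
  have hk := fun k => h.comp_contDiff hf hG (hθ k) (hθ1 k) φ hφ hφc hs
  simp only [Measure.restrict_univ] at hk ⊢
  obtain ⟨C, hC⟩ := hφ1.continuous_gradient.bounded_above_of_compact_support hφc.gradient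
  obtain ⟨M, hM⟩ := hφ1.continuous.bounded_above_of_compact_support hφc
  have hleft : Tendsto (fun k => ∫ x, θ k (f x) • gradient φ x) atTop
      (𝓝 (∫ x, max (f x - l) 0 • gradient φ x)) := by
    refine tendsto_integral_of_dominated_convergence
      (fun x => C * ‖f x‖ + |l| * ‖gradient φ x‖)
      (fun k => ((hθ k).continuous.comp_aestronglyMeasurable hf.aestronglyMeasurable).smul
        hφ1.continuous_gradient.aestronglyMeasurable)
      ((hf.norm.const_mul C).add ((hφ1.continuous_gradient.integrable_of_hasCompactSupport
        hφc.gradient).norm.const_mul _)) (fun k => Eventually.of_forall fun x => ?_)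
      (Eventually.of_forall fun x => ?_)
    · rw [norm_smul]
      have h1 : ‖θ k (f x)‖ ≤ ‖f x‖ + |l| :=
        (norm_smoothPosPart_le (hε k) _).trans (norm_sub_le _ _)
      nlinarith [norm_nonneg (f x), hC x, norm_nonneg (gradient φ x)]
    · exact ((tendsto_smoothPosPart (f x - l)).comp hε0).smul_const _
  have hright : Tendsto (fun k => - ∫ x, φ x • (deriv (θ k) (f x) • G x)) atTop
      (𝓝 (- ∫ x, φ x • ((if l < f x then (1 : ℝ) else 0) • G x))) := by
    refine (tendsto_integral_of_dominated_convergence (fun x => M * ‖G x‖)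
      (fun k => hφ1.continuous.aestronglyMeasurable.smul
        ((((hθ k).continuous_deriv le_rfl).comp_aestronglyMeasurable
          hf.aestronglyMeasurable).smul hG.aestronglyMeasurable))
      (hG.norm.const_mul M)
      (fun k => Eventually.of_forall fun x => norm_deriv_comp_smul_le (hθ1 k) (hM x) _)
      (Eventually.of_forall fun x => ?_)).neg
    have := tendsto_deriv_smoothPosPart (f x - l)
    simp only [sub_pos] at this
    simp only [hθd]
    exact (this.smul_const _).const_smul _
  exact tendsto_nhds_unique hleft (hright.congr fun k => (hk k).symm)

/-- The Gagliardo-Nirenberg-Sobolev inequality for Sobolev functions with compact support. -/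
theorem exists_lintegral_pow_le_of_isWeakGradient (hn : 2 ≤ n) :
    ∃ C : NNReal, ∀ (f : EuclideanSpace ℝ (Fin n) → ℝ)
      (G : EuclideanSpace ℝ (Fin n) → EuclideanSpace ℝ (Fin n)),
      Integrable f → Integrable G → HasCompactSupport f → IsWeakGradient univ f G →
      ∫⁻ x, ‖f x‖ₑ ^ ((n : ℝ) / ((n : ℝ) - 1))
        ≤ C * (∫⁻ x, ‖G x‖ₑ) ^ ((n : ℝ) / ((n : ℝ) - 1)) := by
  set q := (n : ℝ) / ((n : ℝ) - 1) with hq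
  have hn1 : (1 : ℝ) < n := by exact_mod_cast hn
  have hq0 : 0 ≤ q := div_nonneg (by linarith) (by linarith)
  have hconj : Real.HolderConjugate (Module.finrank ℝ (EuclideanSpace ℝ (Fin n))) q := by
    simpa [Real.conjExponent] using Real.HolderConjugate.conjExponent hn1
  refine ⟨lintegralPowLePowLIntegralFDerivConst
    (volume : Measure (EuclideanSpace ℝ (Fin n))) q, fun f G hf hG hc h => ?_⟩
  obtain ⟨F, hFs, hFc, hFl, -, -, hFgle⟩ := exists_smooth_approx_of_isWeakGradient hf hG h
  -- Fatou's lemma reduces the claim to the mollifications, whose gradients have `L¹` norm at most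
  -- that of `G`, so that the constant for `C¹` functions survives.
  calc ∫⁻ x, ‖f x‖ₑ ^ q
      ≤ ∫⁻ x, liminf (fun k => ‖F k x‖ₑ ^ q) atTop := by
        refine lintegral_mono_ae ?_
        filter_upwards [hFl] with x hx
        exact ((ENNReal.continuous_rpow_const (y := q)).tendsto _ |>.comp hx.enorm).liminf_eq.ge
    _ ≤ liminf (fun k => ∫⁻ x, ‖F k x‖ₑ ^ q) atTop :=
        lintegral_liminf_le fun k => ((hFs k).continuous.measurable.enorm).pow_const q
    _ ≤ liminf (fun _ : ℕ => (lintegralPowLePowLIntegralFDerivConst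
          (volume : Measure (EuclideanSpace ℝ (Fin n))) q : ENNReal)
          * (∫⁻ x, ‖G x‖ₑ) ^ q) atTop := by
        refine liminf_le_liminf (Eventually.of_forall fun k => ?_)
        refine (lintegral_pow_le_pow_lintegral_fderiv volume
          ((hFs k).of_le (by exact_mod_cast le_top)) (hFc hc k) hconj).trans ?_
        refine mul_le_mul' le_rfl (ENNReal.rpow_le_rpow ?_ hq0)
        refine le_trans (le_of_eq (lintegral_congr fun x => ?_)) (hFgle k)
        rw [← ofReal_norm, ← ofReal_norm, norm_gradient]
    _ = _ := by simp

/-- The product rule: multiplication by a smooth cutoff function with compact support in `Ω`. -/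
theorem IsWeakGradient.mul_cutoff {Ω : Set (EuclideanSpace ℝ (Fin n))}
    {v : EuclideanSpace ℝ (Fin n) → ℝ} {G : EuclideanSpace ℝ (Fin n) → EuclideanSpace ℝ (Fin n)}
    (h : IsWeakGradient Ω v G) {χ : EuclideanSpace ℝ (Fin n) → ℝ} (hχ : ContDiff ℝ ∞ χ)
    (hχc : HasCompactSupport χ) (hχs : tsupport χ ⊆ Ω) (hv : IntegrableOn v (tsupport χ))
    (hG : IntegrableOn G (tsupport χ)) :
    IsWeakGradient univ (fun x => χ x * v x) (fun x => χ x • G x + v x • gradient χ x) := by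
  intro φ hφ hφc _
  have hχ1 : ContDiff ℝ 1 χ := hχ.of_le (by exact_mod_cast le_top)
  have hφ1 : ContDiff ℝ 1 φ := hφ.of_le (by exact_mod_cast le_top)
  have hz : ∀ x, x ∉ tsupport χ → χ x = 0 := fun x => image_eq_zero_of_notMem_tsupport
  have hz' : ∀ x, x ∉ tsupport χ → gradient χ x = 0 := fun x => gradient_eq_zero_of_notMem_tsupport
  have iv : ∀ ψ : EuclideanSpace ℝ (Fin n) → EuclideanSpace ℝ (Fin n), Continuous ψ →
      (∀ x, x ∉ tsupport χ → ψ x = 0) → Integrable fun x => v x • ψ x := fun ψ hψ hψ0 => by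
    rw [← integrableOn_iff_integrable_of_support_subset (s := tsupport χ)]
    · exact hv.smul_continuousOn hψ.continuousOn hχc.isCompact
    · intro x hx
      by_contra hcon
      exact hx (by simp [hψ0 x hcon])
  have iG : ∀ ψ : EuclideanSpace ℝ (Fin n) → ℝ, Continuous ψ →
      (∀ x, x ∉ tsupport χ → ψ x = 0) → Integrable fun x => ψ x • G x := fun ψ hψ hψ0 => by
    rw [← integrableOn_iff_integrable_of_support_subset (s := tsupport χ)]
    · exact hG.continuousOn_smul hψ.continuousOn hχc.isCompact
    · intro x hx
      by_contra hcon
      exact hx (by simp [hψ0 x hcon])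
  -- `χ φ` is supported in `Ω` even if `φ` is not; this is how the weak gradient in `Ω` yields one
  -- on the whole space.
  have key := h (fun x => χ x * φ x) (hχ.mul hφ) hχc.mul_right
    ((closure_mono fun x hx => left_ne_zero_of_mul hx).trans hχs)
  have hgr : ∀ x, gradient (fun x => χ x * φ x) x = χ x • gradient φ x + φ x • gradient χ x :=
    fun x => gradient_mul_apply (hχ1.differentiable one_ne_zero x)
      (hφ1.differentiable one_ne_zero x)
  simp only [hgr] at key
  have hnot : ∀ x, x ∉ Ω → x ∉ tsupport χ := fun x hx hx' => hx (hχs hx')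
  rw [setIntegral_eq_integral_of_forall_compl_eq_zero
      (fun x hx => by simp [hz x (hnot x hx), hz' x (hnot x hx)]),
    setIntegral_eq_integral_of_forall_compl_eq_zero
      (fun x hx => by simp [hz x (hnot x hx)])] at key
  simp only [Measure.restrict_univ]
  have i1 := iv (fun x => χ x • gradient φ x) (hχ1.continuous.smul hφ1.continuous_gradient)
    fun x hx => by simp [hz x hx]
  have i2 := iv (fun x => φ x • gradient χ x) (hφ1.continuous.smul hχ1.continuous_gradient)
    fun x hx => by simp [hz' x hx]
  have i3 := iG (fun x => χ x * φ x) (hχ1.continuous.mul hφ1.continuous)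
    fun x hx => by simp [hz x hx]
  simp only [smul_add] at key
  rw [integral_add i1 i2] at key
  have e1 : ∫ x, (χ x * v x) • gradient φ x = ∫ x, v x • χ x • gradient φ x :=
    integral_congr_ae (Eventually.of_forall fun x => by simp only [smul_smul, mul_comm])
  have e2 : ∫ x, φ x • (χ x • G x + v x • gradient χ x)
      = ∫ x, ((χ x * φ x) • G x + v x • φ x • gradient χ x) :=
    integral_congr_ae (Eventually.of_forall fun x => by
      simp only [smul_add, smul_smul, mul_comm])
  rw [e1, e2, integral_add i3 i2, neg_add, ← key]
  abel

end SobolevCalculus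

/-! ### Smooth radial cutoff functions with explicit gradient bounds. -/

section RadialCutoff

theorem exists_bound_deriv_smoothTransition :
    ∃ M : ℝ, 0 ≤ M ∧ ∀ s, |deriv Real.smoothTransition s| ≤ M := by
  have hc : Continuous (deriv Real.smoothTransition) :=
    (Real.smoothTransition.contDiff (n := 1)).continuous_deriv le_rfl
  obtain ⟨M, hM⟩ := (isCompact_Icc (a := (0 : ℝ)) (b := 1)).exists_bound_of_continuousOn
    hc.continuousOn
  have hM0 : 0 ≤ M := (norm_nonneg _).trans (hM 0 (by simp))
  refine ⟨M, hM0, fun s => ?_⟩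
  by_cases hs : s ∈ Icc (0 : ℝ) 1
  · exact hM s hs
  · have : deriv Real.smoothTransition s = 0 := by
      rcases not_and_or.mp hs with h | h
      · have : Real.smoothTransition =ᶠ[𝓝 s] fun _ => 0 := by
          filter_upwards [gt_mem_nhds (not_le.mp h)] with y hy
          exact Real.smoothTransition.zero_of_nonpos (le_of_lt hy)
        rw [this.deriv_eq, deriv_const]
      · have : Real.smoothTransition =ᶠ[𝓝 s] fun _ => 1 := by
          filter_upwards [lt_mem_nhds (not_le.mp h)] with y hy
          exact Real.smoothTransition.one_of_one_le (le_of_lt hy)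
        rw [this.deriv_eq, deriv_const]
    simpa [this] using hM0

/-- A bound for the derivative of `Real.smoothTransition`. -/
noncomputable def smoothTransitionDerivBound : ℝ :=
  exists_bound_deriv_smoothTransition.choose

theorem smoothTransitionDerivBound_nonneg : 0 ≤ smoothTransitionDerivBound :=
  exists_bound_deriv_smoothTransition.choose_spec.1

theorem abs_deriv_smoothTransition_le (s : ℝ) :
    |deriv Real.smoothTransition s| ≤ smoothTransitionDerivBound :=
  exists_bound_deriv_smoothTransition.choose_spec.2 s

variable {n : ℕ}

/-- A smooth radial function that is `1` in the ball of radius `s` and `0` outside the ball of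
radius `t`. -/
noncomputable def radialCutoff (s t : ℝ) (x : EuclideanSpace ℝ (Fin n)) : ℝ :=
  Real.smoothTransition ((t ^ 2 - ‖x‖ ^ 2) / (t ^ 2 - s ^ 2))

variable {s t : ℝ}

theorem contDiff_radialCutoff :
    ContDiff ℝ ∞ (radialCutoff s t : EuclideanSpace ℝ (Fin n) → ℝ) :=
  Real.smoothTransition.contDiff.comp ((contDiff_const.sub (contDiff_norm_sq ℝ)).div_const _)

theorem continuous_radialCutoff :
    Continuous (radialCutoff s t : EuclideanSpace ℝ (Fin n) → ℝ) :=
  contDiff_radialCutoff.continuous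

theorem continuous_gradient_radialCutoff :
    Continuous (gradient (radialCutoff s t : EuclideanSpace ℝ (Fin n) → ℝ)) :=
  ContDiff.continuous_gradient (contDiff_radialCutoff.of_le (by exact_mod_cast le_top))

theorem radialCutoff_nonneg (x : EuclideanSpace ℝ (Fin n)) : 0 ≤ radialCutoff s t x :=
  Real.smoothTransition.nonneg _

theorem radialCutoff_le_one (x : EuclideanSpace ℝ (Fin n)) : radialCutoff s t x ≤ 1 :=
  Real.smoothTransition.le_one _

theorem radialCutoff_eq_one (hs : 0 < s) (hst : s < t) {x : EuclideanSpace ℝ (Fin n)}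
    (hx : ‖x‖ ≤ s) : radialCutoff s t x = 1 := by
  refine Real.smoothTransition.one_of_one_le ?_
  rw [le_div_iff₀ (by nlinarith)]
  nlinarith [norm_nonneg x]

theorem radialCutoff_eq_zero (hs : 0 < s) (hst : s < t) {x : EuclideanSpace ℝ (Fin n)}
    (hx : t ≤ ‖x‖) : radialCutoff s t x = 0 := by
  refine Real.smoothTransition.zero_of_nonpos (div_nonpos_of_nonpos_of_nonneg ?_ ?_) <;> nlinarith

theorem tsupport_radialCutoff_subset (hs : 0 < s) (hst : s < t) :
    tsupport (radialCutoff s t : EuclideanSpace ℝ (Fin n) → ℝ) ⊆ Metric.closedBall 0 t := by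
  refine closure_minimal (fun x hx => ?_) Metric.isClosed_closedBall
  rw [mem_closedBall_zero_iff]
  by_contra h
  exact hx (radialCutoff_eq_zero hs hst (not_le.mp h).le)

theorem hasCompactSupport_radialCutoff (hs : 0 < s) (hst : s < t) :
    HasCompactSupport (radialCutoff s t : EuclideanSpace ℝ (Fin n) → ℝ) :=
  (isCompact_closedBall _ _).of_isClosed_subset (isClosed_tsupport _)
    (tsupport_radialCutoff_subset hs hst)

theorem gradient_radialCutoff_eq_zero_of_lt (hs : 0 < s) (hst : s < t)
    {x : EuclideanSpace ℝ (Fin n)} (hx : ‖x‖ < s) : gradient (radialCutoff s t) x = 0 := by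
  have : radialCutoff s t =ᶠ[𝓝 x] fun _ => (1 : ℝ) := by
    filter_upwards [continuous_norm.continuousAt.eventually_lt continuousAt_const hx] with y hy
    exact radialCutoff_eq_one hs hst (le_of_lt hy)
  rw [this.gradient_eq, gradient_fun_const]

theorem gradient_radialCutoff_eq_zero_of_gt (hs : 0 < s) (hst : s < t)
    {x : EuclideanSpace ℝ (Fin n)} (hx : t < ‖x‖) : gradient (radialCutoff s t) x = 0 :=
  gradient_eq_zero_of_notMem_tsupport fun h =>
    hx.not_ge (mem_closedBall_zero_iff.mp (tsupport_radialCutoff_subset hs hst h))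

/-- The quadratic argument of the transition function has gradient of norm `2 ‖x‖ / (t ^ 2 - s ^
2)`, at most `2 / (t - s)` for `‖x‖ ≤ t`. Only the width of the annulus enters, as hole filling and
the De Giorgi iteration require. -/
theorem norm_gradient_radialCutoff_le (hs : 0 < s) (hst : s < t)
    (x : EuclideanSpace ℝ (Fin n)) :
    ‖gradient (radialCutoff s t) x‖ ≤ 2 * smoothTransitionDerivBound / (t - s) := by
  have hM := smoothTransitionDerivBound_nonneg
  rcases lt_or_ge t ‖x‖ with hx | hx
  · rw [gradient_radialCutoff_eq_zero_of_gt hs hst hx, norm_zero]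
    exact div_nonneg (by linarith) (by linarith)
  have hpos : 0 < t ^ 2 - s ^ 2 := by nlinarith
  have h1 : HasFDerivAt (fun y : EuclideanSpace ℝ (Fin n) => (t ^ 2 - ‖y‖ ^ 2) / (t ^ 2 - s ^ 2))
      ((t ^ 2 - s ^ 2)⁻¹ • (-(2 • innerSL ℝ x) : EuclideanSpace ℝ (Fin n) →L[ℝ] ℝ)) x := by
    have := ((hasStrictFDerivAt_norm_sq x).hasFDerivAt.const_sub (t ^ 2)).const_mul
      ((t ^ 2 - s ^ 2)⁻¹)
    simpa only [div_eq_inv_mul] using this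
  have h2 : HasFDerivAt (radialCutoff s t : EuclideanSpace ℝ (Fin n) → ℝ) _ x :=
    (((Real.smoothTransition.contDiff (n := 1)).differentiable one_ne_zero
      _).hasDerivAt).comp_hasFDerivAt x h1
  rw [norm_gradient, h2.fderiv, norm_smul, norm_smul, norm_neg, Real.norm_eq_abs, Real.norm_eq_abs,
    abs_of_pos (inv_pos.mpr hpos), two_smul, ← two_smul ℝ, norm_smul, innerSL_apply_norm]
  calc _ ≤ smoothTransitionDerivBound * ((t ^ 2 - s ^ 2)⁻¹ * (‖(2 : ℝ)‖ * ‖x‖)) := by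
        gcongr
        exact abs_deriv_smoothTransition_le _
    _ ≤ smoothTransitionDerivBound * (2 / (t - s)) := by
        gcongr
        rw [inv_mul_le_iff₀ hpos, Real.norm_ofNat]
        have : (t ^ 2 - s ^ 2) * (2 / (t - s)) = 2 * (t + s) := by
          have : t - s ≠ 0 := by linarith
          field_simp
          ring
        rw [this]
        linarith
    _ = _ := by ring

end RadialCutoff

/-! ### The localized truncation and the competitor built from it. -/

section Truncation

variable {n : ℕ}

/-- The truncation `η (u - l)₊` of `u` above the level `l`, localized by a cutoff function `η`. -/
noncomputable def truncation (l s t : ℝ) (u : EuclideanSpace ℝ (Fin n) → ℝ)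
    (x : EuclideanSpace ℝ (Fin n)) : ℝ :=
  radialCutoff s t x * max (u x - l) 0

/-- The weak gradient of `truncation l s t u`, where `G` is the weak gradient of `u`. -/
noncomputable def truncationGradient (l s t : ℝ) (u : EuclideanSpace ℝ (Fin n) → ℝ)
    (G : EuclideanSpace ℝ (Fin n) → EuclideanSpace ℝ (Fin n))
    (x : EuclideanSpace ℝ (Fin n)) : EuclideanSpace ℝ (Fin n) :=
  radialCutoff s t x • ((if l < u x then (1 : ℝ) else 0) • G x)
    + max (u x - l) 0 • gradient (radialCutoff s t) x

/-- A minimizer in `Ω`, together with its weak gradient `G`, both of them measurable on the whole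
space. -/
structure IsMeasurableMinimizer (p : ℝ)
    (F : EuclideanSpace ℝ (Fin n) → ℝ → EuclideanSpace ℝ (Fin n) → ℝ)
    (W : ℝ → EuclideanSpace ℝ (Fin n) → ℝ) (Ω : Set (EuclideanSpace ℝ (Fin n)))
    (u : EuclideanSpace ℝ (Fin n) → ℝ)
    (G : EuclideanSpace ℝ (Fin n) → EuclideanSpace ℝ (Fin n)) : Prop where
  measurable : Measurable u
  measurable_gradient : Measurable G
  mem_Icc : ∀ x, u x ∈ Icc (-1 : ℝ) 1
  memW1pLoc : MemW1pLoc p Ω u G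
  energy_le : ∀ D : Set (EuclideanSpace ℝ (Fin n)), IsOpen D → Bornology.IsBounded D →
    closure D ⊆ Ω → ∀ (v : EuclideanSpace ℝ (Fin n) → ℝ)
      (H : EuclideanSpace ℝ (Fin n) → EuclideanSpace ℝ (Fin n)), Admissible p Ω v H →
      (∀ x, x ∉ D → v x = u x) → energy F W u G D ≤ energy F W v H D

variable {p : ℝ} {Ω : Set (EuclideanSpace ℝ (Fin n))} {u : EuclideanSpace ℝ (Fin n) → ℝ}
  {G : EuclideanSpace ℝ (Fin n) → EuclideanSpace ℝ (Fin n)} {l s t ρ : ℝ}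

theorem MemW1pLoc.integrableOn_gradient (h : MemW1pLoc p Ω u G) (hp : 1 < p)
    {K : Set (EuclideanSpace ℝ (Fin n))} (hK : IsCompact K) (hKΩ : K ⊆ Ω) : IntegrableOn G K := by
  have : IsFiniteMeasure (volume.restrict K) := isFiniteMeasure_restrict.mpr hK.measure_ne_top
  exact (h.memLp_gradient K hK hKΩ).integrable (by simpa using hp.le)

theorem MemW1pLoc.integrableOn (h : MemW1pLoc p Ω u G) (hp : 1 < p)
    {K : Set (EuclideanSpace ℝ (Fin n))} (hK : IsCompact K) (hKΩ : K ⊆ Ω) : IntegrableOn u K := by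
  have : IsFiniteMeasure (volume.restrict K) := isFiniteMeasure_restrict.mpr hK.measure_ne_top
  exact (h.memLp K hK hKΩ).integrable (by simpa using hp.le)

/-- The calculus on the whole space needs integrable functions, while `u` is controlled only locally
in `Ω`. Two cutoffs are therefore used: one equal to `1` on the ball of radius `t` makes `u` global
without changing it there, the positive part is taken next, and the cutoff between `s` and `t` is
applied last. -/
theorem isWeakGradient_truncation (hu : Measurable u) (hp : 1 < p) (h : MemW1pLoc p Ω u G)
    (hΩ : Metric.ball 0 ρ ⊆ Ω) (hs : 0 < s) (hst : s < t) (ht : t < ρ) :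
    IsWeakGradient univ (truncation l s t u) (truncationGradient l s t u G) := by
  obtain ⟨t', htt', ht'⟩ := exists_between ht
  have ht0 : 0 < t := hs.trans hst
  have hsub : tsupport (radialCutoff t t' : EuclideanSpace ℝ (Fin n) → ℝ) ⊆ Ω :=
    ((tsupport_radialCutoff_subset ht0 htt').trans (Metric.closedBall_subset_ball ht')).trans hΩ
  have hc := hasCompactSupport_radialCutoff (n := n) ht0 htt'
  have iu := h.integrableOn hp hc.isCompact hsub
  have iG := h.integrableOn_gradient hp hc.isCompact hsub
  set U : EuclideanSpace ℝ (Fin n) → ℝ := fun x => radialCutoff t t' x * u x with hU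
  set GU : EuclideanSpace ℝ (Fin n) → EuclideanSpace ℝ (Fin n) := fun x =>
    radialCutoff t t' x • G x + u x • gradient (radialCutoff t t') x with hGU
  have w1 : IsWeakGradient univ U GU :=
    h.isWeakGradient.mul_cutoff contDiff_radialCutoff hc hsub iu iG
  have iU : Integrable U := by
    rw [← integrableOn_iff_integrable_of_support_subset
      (s := tsupport (radialCutoff t t' : EuclideanSpace ℝ (Fin n) → ℝ))]
    · exact iu.continuousOn_mul continuous_radialCutoff.continuousOn hc.isCompact
    · intro x hx
      exact subset_tsupport _ (left_ne_zero_of_mul hx)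
  have iGU : Integrable GU := by
    rw [← integrableOn_iff_integrable_of_support_subset
      (s := tsupport (radialCutoff t t' : EuclideanSpace ℝ (Fin n) → ℝ))]
    · exact (iG.continuousOn_smul continuous_radialCutoff.continuousOn hc.isCompact).add
        (iu.smul_continuousOn continuous_gradient_radialCutoff.continuousOn hc.isCompact)
    · intro x hx
      by_contra hcon
      refine hx ?_
      simp [hGU, image_eq_zero_of_notMem_tsupport hcon, gradient_eq_zero_of_notMem_tsupport hcon]
  have w2 := w1.posPart_sub_const iU iGU l
  have mU : MeasurableSet {x | l < U x} :=
    measurableSet_lt measurable_const (continuous_radialCutoff.measurable.mul hu)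
  -- For `l < 0` this function equals `-l` where `U` vanishes, so it is only locally integrable.
  have iT : LocallyIntegrable fun x => max (U x - l) 0 :=
    (((iU.locallyIntegrable.sub (locallyIntegrable_const l))).mono
      (((iU.aestronglyMeasurable.sub aestronglyMeasurable_const)).sup aestronglyMeasurable_const)
      (Eventually.of_forall fun x => by
        simp only [Real.norm_eq_abs, Pi.sub_apply]
        rw [abs_of_nonneg (le_sup_right)]
        exact max_le (le_abs_self _) (abs_nonneg _)))
  have iGT : Integrable fun x => (if l < U x then (1 : ℝ) else 0) • GU x := by
    refine (iGU.indicator mU).congr (Eventually.of_forall fun x => ?_)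
    by_cases hx : l < U x <;> simp [indicator, hx]
  have hc' := hasCompactSupport_radialCutoff (n := n) hs hst
  have w3 := w2.mul_cutoff contDiff_radialCutoff hc' (subset_univ _)
    (iT.integrableOn_isCompact hc'.isCompact) iGT.integrableOn
  have hχ : ∀ x : EuclideanSpace ℝ (Fin n), ‖x‖ ≤ t → U x = u x := fun x hx => by
    rw [hU]
    simp [radialCutoff_eq_one ht0 htt' hx]
  convert w3 using 1
  · ext1 x
    rcases le_total ‖x‖ t with hx | hx
    · simp only [truncation, hχ x hx]
    · simp only [truncation, radialCutoff_eq_zero hs hst hx, zero_mul]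
  · ext1 x
    rcases lt_trichotomy ‖x‖ t with hx | hx | hx
    · have : GU x = G x := by
        simp [hGU, radialCutoff_eq_one ht0 htt' hx.le,
          gradient_radialCutoff_eq_zero_of_lt ht0 htt' hx]
      simp only [truncationGradient, hχ x hx.le, this]
    -- On the sphere `‖x‖ = t` the last cutoff is already zero, so `GU x` and `G x` need not agree.
    · simp only [truncationGradient, radialCutoff_eq_zero hs hst hx.ge, zero_smul, hχ x hx.le]
    · simp only [truncationGradient, radialCutoff_eq_zero hs hst hx.le, zero_smul,
        gradient_radialCutoff_eq_zero_of_gt hs hst hx, smul_zero]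

theorem truncation_nonneg (x : EuclideanSpace ℝ (Fin n)) : 0 ≤ truncation l s t u x :=
  mul_nonneg (radialCutoff_nonneg x) (le_max_right _ _)

theorem truncation_le (x : EuclideanSpace ℝ (Fin n)) : truncation l s t u x ≤ max (u x - l) 0 :=
  mul_le_of_le_one_left (le_max_right _ _) (radialCutoff_le_one x)

theorem measurable_truncation (hu : Measurable u) : Measurable (truncation l s t u) :=
  continuous_radialCutoff.measurable.mul ((hu.sub_const l).max measurable_const)

theorem measurable_truncationGradient (hu : Measurable u) (hG : Measurable G) :
    Measurable (truncationGradient l s t u G) := by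
  have h1 : Measurable fun x => if l < u x then (1 : ℝ) else 0 :=
    Measurable.ite (measurableSet_lt measurable_const hu) measurable_const measurable_const
  have h2 : Measurable fun x => max (u x - l) 0 := (hu.sub_const l).max measurable_const
  have h3 : Measurable (radialCutoff s t : EuclideanSpace ℝ (Fin n) → ℝ) :=
    continuous_radialCutoff.measurable
  have h4 : Measurable (gradient (radialCutoff s t : EuclideanSpace ℝ (Fin n) → ℝ)) :=
    continuous_gradient_radialCutoff.measurable
  exact (h3.smul (h1.smul hG)).add (h2.smul h4)

theorem norm_truncationGradient_le {x : EuclideanSpace ℝ (Fin n)} (hu : u x ≤ 1) (hl : -1 ≤ l) (hs : 0 < s) (hst : s < t) :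
    ‖truncationGradient l s t u G x‖
      ≤ ‖G x‖ + 4 * smoothTransitionDerivBound / (t - s) := by
  have h1 : ‖radialCutoff s t x • ((if l < u x then (1 : ℝ) else 0) • G x)‖ ≤ ‖G x‖ := by
    rw [norm_smul, norm_smul, ← mul_assoc]
    refine mul_le_of_le_one_left (norm_nonneg _) ?_
    rw [Real.norm_eq_abs, abs_of_nonneg (radialCutoff_nonneg x)]
    refine mul_le_one₀ (radialCutoff_le_one x) (norm_nonneg _) ?_
    split_ifs <;> simp
  have h2 : ‖max (u x - l) 0 • gradient (radialCutoff s t) x‖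
      ≤ 4 * smoothTransitionDerivBound / (t - s) := by
    rw [norm_smul, Real.norm_eq_abs, abs_of_nonneg (le_max_right _ _)]
    calc _ ≤ 2 * (2 * smoothTransitionDerivBound / (t - s)) :=
          mul_le_mul (max_le (by linarith) (by norm_num)) (norm_gradient_radialCutoff_le hs hst x)
            (norm_nonneg _) (by norm_num)
      _ = _ := by ring
  exact (norm_add_le _ _).trans (add_le_add h1 h2)

/-- The vanishing is pointwise, so the two energy integrands are literally equal where `u ≤ l`,
whatever `F` and `W` are. -/
theorem truncationGradient_eq_zero (hs : 0 < s) (hst : s < t) {x : EuclideanSpace ℝ (Fin n)}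
    (hx : u x ≤ l ∨ t < ‖x‖) : truncationGradient l s t u G x = 0 := by
  rcases hx with h | h
  · simp [truncationGradient, not_lt.mpr h, max_eq_right (sub_nonpos.mpr h)]
  · simp [truncationGradient, radialCutoff_eq_zero hs hst h.le,
      gradient_radialCutoff_eq_zero_of_gt hs hst h]

/-- The competitor `u - η (u - l)₊` is admissible. -/
theorem admissible_sub_truncation (hu : Measurable u) (hGm : Measurable G)
    (hu1 : ∀ x, u x ∈ Icc (-1 : ℝ) 1) (hp : 1 < p) (h : MemW1pLoc p Ω u G)
    (hΩ : Metric.ball 0 ρ ⊆ Ω) (hl : -1 ≤ l) (hs : 0 < s) (hst : s < t) (ht : t < ρ) :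
    Admissible p Ω (fun x => u x - truncation l s t u x)
      (fun x => G x - truncationGradient l s t u G x) := by
  have hb : ∀ x, u x - truncation l s t u x ∈ Icc (-1 : ℝ) 1 := fun x => by
    refine ⟨?_, by linarith [truncation_nonneg (l := l) (s := s) (t := t) (u := u) x, (hu1 x).2]⟩
    have := truncation_le (l := l) (s := s) (t := t) (u := u) x
    rcases le_total (u x - l) 0 with h0 | h0
    · rw [max_eq_right h0] at this
      linarith [(hu1 x).1]
    · rw [max_eq_left h0] at this
      linarith
  have htr : ∀ K : Set (EuclideanSpace ℝ (Fin n)), IsCompact K → K ⊆ Ω →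
      MemLp (truncationGradient l s t u G) (ENNReal.ofReal p) (volume.restrict K) := by
    intro K hK hKΩ
    have : IsFiniteMeasure (volume.restrict K) := isFiniteMeasure_restrict.mpr hK.measure_ne_top
    refine ((h.memLp_gradient K hK hKΩ).norm.add
      (memLp_const (4 * smoothTransitionDerivBound / (t - s)))).of_le
      (measurable_truncationGradient hu hGm).aestronglyMeasurable
      (Eventually.of_forall fun x => ?_)
    refine (norm_truncationGradient_le (hu1 x).2 hl hs hst).trans ?_
    exact le_abs_self _
  refine ⟨⟨fun K hK hKΩ => ?_, fun K hK hKΩ => (h.memLp_gradient K hK hKΩ).sub (htr K hK hKΩ),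
    ?_⟩, Eventually.of_forall hb⟩
  · have : IsFiniteMeasure (volume.restrict K) := isFiniteMeasure_restrict.mpr hK.measure_ne_top
    exact MemLp.of_bound (hu.sub (measurable_truncation hu)).aestronglyMeasurable 1
      (Eventually.of_forall fun x => abs_le.mpr (hb x))
  · intro φ hφ hφc hφs
    have hφ1 : ContDiff ℝ 1 φ := hφ.of_le (by exact_mod_cast le_top)
    have hw := isWeakGradient_truncation (l := l) hu hp h hΩ hs hst ht φ hφ hφc (subset_univ _)
    have hu' := h.isWeakGradient φ hφ hφc hφs
    have hnot : ∀ x, x ∉ Ω → x ∉ tsupport φ := fun x hx hx' => hx (hφs hx')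
    have hz : ∀ x, x ∉ Ω → φ x = 0 := fun x hx => image_eq_zero_of_notMem_tsupport (hnot x hx)
    have hz' : ∀ x, x ∉ Ω → gradient φ x = 0 := fun x hx =>
      gradient_eq_zero_of_notMem_tsupport (hnot x hx)
    rw [setIntegral_univ, setIntegral_univ,
      ← setIntegral_eq_integral_of_forall_compl_eq_zero (s := Ω)
        (f := fun x => truncation l s t u x • gradient φ x) (fun x hx => by simp [hz' x hx]),
      ← setIntegral_eq_integral_of_forall_compl_eq_zero (s := Ω)
        (f := fun x => φ x • truncationGradient l s t u G x) (fun x hx => by simp [hz x hx])] at hw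
    have iv : ∀ w : EuclideanSpace ℝ (Fin n) → ℝ, IntegrableOn w (tsupport φ) →
        IntegrableOn (fun x => w x • gradient φ x) Ω := fun w hw => by
      refine Integrable.integrableOn ?_
      rw [← integrableOn_iff_integrable_of_support_subset (s := tsupport φ)]
      · exact hw.smul_continuousOn hφ1.continuous_gradient.continuousOn hφc.isCompact
      · intro x hx
        by_contra hcon
        exact hx (by simp [gradient_eq_zero_of_notMem_tsupport hcon])
    have iG : ∀ w : EuclideanSpace ℝ (Fin n) → EuclideanSpace ℝ (Fin n),
        IntegrableOn w (tsupport φ) → IntegrableOn (fun x => φ x • w x) Ω := fun w hw => by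
      refine Integrable.integrableOn ?_
      rw [← integrableOn_iff_integrable_of_support_subset (s := tsupport φ)]
      · exact hw.continuousOn_smul hφ1.continuous.continuousOn hφc.isCompact
      · intro x hx
        by_contra hcon
        exact hx (by simp [image_eq_zero_of_notMem_tsupport hcon])
    have : IsFiniteMeasure (volume.restrict (tsupport φ)) :=
      isFiniteMeasure_restrict.mpr hφc.isCompact.measure_ne_top
    have itr : IntegrableOn (truncation l s t u) (tsupport φ) :=
      Integrable.of_bound (measurable_truncation hu).aestronglyMeasurable 2
        (Eventually.of_forall fun x => by
          rw [Real.norm_eq_abs, abs_of_nonneg (truncation_nonneg x)]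
          exact (truncation_le x).trans (max_le (by linarith [(hu1 x).2]) (by norm_num)))
    have itG : IntegrableOn (truncationGradient l s t u G) (tsupport φ) :=
      (htr _ hφc.isCompact hφs).integrable (by simpa using hp.le)
    simp only [sub_smul, smul_sub]
    rw [integral_sub (iv _ (h.integrableOn hp hφc.isCompact hφs)) (iv _ itr),
      integral_sub (iG _ (h.integrableOn_gradient hp hφc.isCompact hφs)) (iG _ itG), hw, hu']
    abel

end Truncation

/-! ### Energy comparison, hole filling and the Caccioppoli inequality. -/

section Caccioppoli

variable {n : ℕ}

/-- The part of the ball of radius `r` where `u` is above the level `l`. -/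
def superlevel (u : EuclideanSpace ℝ (Fin n) → ℝ) (l r : ℝ) : Set (EuclideanSpace ℝ (Fin n)) :=
  {x | ‖x‖ < r ∧ l < u x}

theorem measurableSet_superlevel {u : EuclideanSpace ℝ (Fin n) → ℝ} (hu : Measurable u)
    (l r : ℝ) : MeasurableSet (superlevel u l r) :=
  (measurableSet_lt measurable_norm measurable_const).inter (measurableSet_lt measurable_const hu)

theorem superlevel_subset_ball (u : EuclideanSpace ℝ (Fin n) → ℝ) (l r : ℝ) :
    superlevel u l r ⊆ Metric.ball 0 r := fun _ hx => mem_ball_zero_iff.mpr hx.1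

theorem superlevel_mono (u : EuclideanSpace ℝ (Fin n) → ℝ) {l l' r r' : ℝ} (hl : l ≤ l')
    (hr : r' ≤ r) : superlevel u l' r' ⊆ superlevel u l r :=
  fun _ hx => ⟨hx.1.trans_le hr, hl.trans_lt hx.2⟩

theorem volume_superlevel_ne_top (u : EuclideanSpace ℝ (Fin n) → ℝ) (l r : ℝ) :
    volume (superlevel u l r) ≠ ⊤ :=
  ((measure_mono (superlevel_subset_ball u l r)).trans_lt measure_ball_lt_top).ne

variable {p m lam : ℝ} {F : EuclideanSpace ℝ (Fin n) → ℝ → EuclideanSpace ℝ (Fin n) → ℝ}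
  {W : ℝ → EuclideanSpace ℝ (Fin n) → ℝ} {Ω : Set (EuclideanSpace ℝ (Fin n))}
  {u : EuclideanSpace ℝ (Fin n) → ℝ} {G : EuclideanSpace ℝ (Fin n) → EuclideanSpace ℝ (Fin n)}
  {ρ s t l σ b c : ℝ}

theorem AssumptionB.nonneg (hB : AssumptionB m lam W) (hlam : 0 < lam) {τ : ℝ}
    (hτ : τ ∈ Icc (-1 : ℝ) 1) (x : EuclideanSpace ℝ (Fin n)) : 0 ≤ W τ x := by
  refine le_trans ?_ (hB τ x hτ).1
  have : 0 ≤ 1 - τ ^ 2 := by nlinarith [hτ.1, hτ.2]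
  positivity

theorem AssumptionB.le (hB : AssumptionB m lam W) (hm : 0 ≤ m) (hlam : 0 < lam) {τ : ℝ}
    (hτ : τ ∈ Icc (-1 : ℝ) 1) (x : EuclideanSpace ℝ (Fin n)) : W τ x ≤ lam := by
  refine (hB τ x hτ).2.trans (mul_le_of_le_one_right hlam.le ?_)
  exact Real.rpow_le_one (by nlinarith [hτ.1, hτ.2]) (by nlinarith [sq_nonneg τ]) hm

theorem MemW1pLoc.integrableOn_norm_rpow (h : MemW1pLoc p Ω u G) (hp : 1 < p)
    {K : Set (EuclideanSpace ℝ (Fin n))} (hK : IsCompact K) (hKΩ : K ⊆ Ω) :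
    IntegrableOn (fun x => ‖G x‖ ^ p) K := by
  have := (h.memLp_gradient K hK hKΩ).integrable_norm_rpow (by simpa using by linarith) (by simp)
  rwa [ENNReal.toReal_ofReal (by linarith)] at this

theorem lintegral_superlevel_ofReal_ne_top {f : EuclideanSpace ℝ (Fin n) → ℝ} {C : ℝ}
    (hf : ∀ x, f x ≤ C) (N : Set (EuclideanSpace ℝ (Fin n))) (hN : volume N ≠ ⊤) :
    ∫⁻ x in N, ENNReal.ofReal (f x) ≠ ⊤ := by
  refine ((lintegral_mono (g := fun _ => ENNReal.ofReal C) fun x =>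
    ENNReal.ofReal_le_ofReal (hf x)).trans_lt ?_).ne
  rw [setLIntegral_const]
  exact ENNReal.mul_lt_top ENNReal.ofReal_lt_top hN.lt_top

/-- Comparison of the energies of a minimizer `u` and of the competitor `u - η (u - l)₊`. -/
theorem IsMeasurableMinimizer.lintegral_superlevel_le (h : IsMeasurableMinimizer p F W Ω u G)
    (hA : AssumptionA p lam F) (hB : AssumptionB m lam W) (hC : AssumptionC W) (hp : 1 < p)
    (hm : 0 ≤ m) (hlam : 0 < lam) (hΩ : Metric.ball 0 ρ ⊆ Ω) (hl : -1 ≤ l) (hlσ : l ≤ σ)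
    (hσ : σ ≤ 0) (hub : ∀ᵐ x ∂(volume.restrict (Metric.ball 0 ρ)), u x ≤ b)
    (hc : 0 ≤ c) (hgap : ∀ x, ∀ τ, σ < τ → τ ≤ b → W l x + c ≤ W τ x)
    (hs : 0 < s) (hst : s < t) (ht : t < ρ) :
    ∫⁻ x in superlevel u l s, ENNReal.ofReal (lam⁻¹ * ‖G x‖ ^ p + if σ < u x then c else 0)
      ≤ ∫⁻ x in superlevel u l t \ superlevel u l s, ENNReal.ofReal
          (lam * (‖G x - truncationGradient l s t u G x‖ ^ p + if σ < u x then 1 else 0)) := by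
  have hum := h.measurable
  have hGm := h.measurable_gradient
  set As := superlevel u l s with hAs
  set At := superlevel u l t with hAt
  set v : EuclideanSpace ℝ (Fin n) → ℝ := fun x => u x - truncation l s t u x with hv
  set H : EuclideanSpace ℝ (Fin n) → EuclideanSpace ℝ (Fin n) :=
    fun x => G x - truncationGradient l s t u G x with hH
  have mAs : MeasurableSet As := measurableSet_superlevel hum l s
  have mAt : MeasurableSet At := measurableSet_superlevel hum l t
  have mB : MeasurableSet {x | l < u x} := measurableSet_lt measurable_const hum
  have mσ : MeasurableSet {x | σ < u x} := measurableSet_lt measurable_const hum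
  have hsub : As ⊆ At := superlevel_mono u le_rfl hst.le
  have l1 : l ∈ Icc (-1 : ℝ) 1 := ⟨hl, by linarith⟩
  have hDΩ : Metric.closedBall 0 t ⊆ Ω := (Metric.closedBall_subset_ball ht).trans hΩ
  have hvI : ∀ x, l < u x → l ≤ v x ∧ v x ≤ u x := fun x hx => by
    have h1 := truncation_nonneg (l := l) (s := s) (t := t) (u := u) x
    have h2 := truncation_le (l := l) (s := s) (t := t) (u := u) x
    rw [max_eq_left (by linarith)] at h2
    simp only [hv]
    constructor <;> linarith
  set fu : EuclideanSpace ℝ (Fin n) → ENNReal :=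
    fun x => ENNReal.ofReal (F (G x) (u x) x + W (u x) x) with hfu
  set fv : EuclideanSpace ℝ (Fin n) → ENNReal :=
    fun x => ENNReal.ofReal (F (H x) (v x) x + W (v x) x) with hfv
  have hmin : ∫⁻ x in Metric.ball 0 t, fu x ≤ ∫⁻ x in Metric.ball 0 t, fv x :=
    h.energy_le (Metric.ball 0 t) Metric.isOpen_ball Metric.isBounded_ball
      (Metric.closure_ball_subset_closedBall.trans hDΩ) v H
      (admissible_sub_truncation hum hGm h.mem_Icc hp h.memW1pLoc hΩ hl hs hst ht)
      (fun x hx => by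
        have : t ≤ ‖x‖ := by simpa using hx
        simp [hv, truncation, radialCutoff_eq_zero hs hst this])
  have hfin : ∫⁻ x in Metric.ball 0 t, fu x ≠ ⊤ := by
    have hi : IntegrableOn (fun x => lam * ‖G x‖ ^ p + lam) (Metric.ball 0 t) :=
      (((h.memW1pLoc.integrableOn_norm_rpow hp (isCompact_closedBall 0 t) hDΩ).mono_set
        Metric.ball_subset_closedBall).const_mul lam).add
        (integrableOn_const measure_ball_lt_top.ne)
    refine ((lintegral_mono fun x => ?_).trans_lt hi.lintegral_lt_top).ne
    exact ENNReal.ofReal_le_ofReal (add_le_add (hA _ _ _ (h.mem_Icc x)).2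
      (hB.le hm hlam (h.mem_Icc x) x))
  have hDB : Metric.ball 0 t ∩ {x | l < u x} = At := by
    ext x
    simp [hAt, superlevel]
  have heq : ∫⁻ x in Metric.ball 0 t \ {x | l < u x}, fv x
      = ∫⁻ x in Metric.ball 0 t \ {x | l < u x}, fu x := by
    refine setLIntegral_congr_fun (measurableSet_ball.diff mB) fun x hx => ?_
    have hxl : u x ≤ l := not_lt.mp hx.2
    have e1 : v x = u x := by simp [hv, truncation, max_eq_right (sub_nonpos.mpr hxl)]
    have e2 : H x = G x := by
      simp [hH, truncationGradient_eq_zero (G := G) hs hst (Or.inl hxl)]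
    simp only [hfu, hfv, e1, e2]
  -- The finite contribution of `{u ≤ l}`, common to both energies, is cancelled. Splitting over a
  -- measurable set is legitimate for non-measurable integrands.
  have hcmp : ∫⁻ x in At, fu x ≤ ∫⁻ x in At, fv x := by
    rw [← lintegral_inter_add_sdiff fu (Metric.ball 0 t) mB,
      ← lintegral_inter_add_sdiff fv (Metric.ball 0 t) mB, heq, hDB] at hmin
    refine (ENNReal.add_le_add_iff_right (ne_top_of_le_ne_top hfin ?_)).mp hmin
    exact lintegral_mono_set sdiff_subset
  rw [← lintegral_inter_add_sdiff fu At mAs, ← lintegral_inter_add_sdiff fv At mAs,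
    inter_eq_self_of_subset_right hsub] at hcmp
  -- Additivity of the lower integral needs only one measurable summand: the term with `W` is kept
  -- on the left, and the explicit density in `G` and `u` is the measurable one.
  have hlow1 : (∫⁻ x in As, ENNReal.ofReal (W l x))
      + ∫⁻ x in As, ENNReal.ofReal (lam⁻¹ * ‖G x‖ ^ p + if σ < u x then c else 0)
      ≤ ∫⁻ x in As, fu x := by
    rw [← lintegral_add_right]
    · refine lintegral_mono_ae ?_
      have hss : As ⊆ Metric.ball 0 ρ :=
        (superlevel_subset_ball u l s).trans (Metric.ball_subset_ball (hst.trans ht).le)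
      filter_upwards [ae_restrict_mem mAs, ae_restrict_of_ae_restrict_of_subset hss hub]
        with x hx hxb
      rw [← ENNReal.ofReal_add (hB.nonneg hlam l1 x) (by positivity)]
      refine ENNReal.ofReal_le_ofReal ?_
      have h1 := (hA (G x) _ x (h.mem_Icc x)).1
      have h2 : W l x + (if σ < u x then c else 0) ≤ W (u x) x := by
        split_ifs with hσu
        · exact hgap x _ hσu hxb
        · rw [add_zero]
          have := not_lt.mp hσu
          exact (hC x).1 ⟨hl, hlσ.trans hσ⟩ ⟨hl.trans hx.2.le, this.trans hσ⟩ hx.2.le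
      linarith
    · exact (((hGm.norm.pow_const p).const_mul _).add
        (Measurable.ite mσ measurable_const measurable_const)).ennreal_ofReal
  -- On the inner set the competitor is the constant `l` with zero gradient, and `F` vanishes at `ξ
  -- = 0` by the growth condition.
  have hup1 : ∫⁻ x in As, fv x = ∫⁻ x in As, ENNReal.ofReal (W l x) := by
    refine setLIntegral_congr_fun mAs fun x hx => ?_
    have e1 : v x = l := by
      simp [hv, truncation, radialCutoff_eq_one hs hst hx.1.le,
        max_eq_left (sub_nonneg.mpr hx.2.le)]
    have e2 : H x = 0 := by
      simp [hH, truncationGradient, radialCutoff_eq_one hs hst hx.1.le, hx.2,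
        gradient_radialCutoff_eq_zero_of_lt hs hst hx.1]
    have e3 : F 0 l x = 0 := by
      have := hA 0 l x l1
      rw [norm_zero, Real.zero_rpow (by linarith), mul_zero, mul_zero] at this
      exact le_antisymm this.2 this.1
    simp only [hfv, e1, e2, e3, zero_add]
  have hlow2 : ∫⁻ x in At \ As, ENNReal.ofReal (W (u x) x) ≤ ∫⁻ x in At \ As, fu x := by
    refine lintegral_mono fun x => ENNReal.ofReal_le_ofReal ?_
    have h1 := (hA (G x) _ x (h.mem_Icc x)).1
    have : 0 ≤ lam⁻¹ * ‖G x‖ ^ p := by positivity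
    linarith
  have hup2 : ∫⁻ x in At \ As, fv x ≤ (∫⁻ x in At \ As, ENNReal.ofReal (W (u x) x))
      + ∫⁻ x in At \ As, ENNReal.ofReal (lam * (‖H x‖ ^ p + if σ < u x then 1 else 0)) := by
    rw [← lintegral_add_right]
    · refine setLIntegral_mono_ae' (mAt.diff mAs) (Eventually.of_forall fun x hx => ?_)
      obtain ⟨hv1, hv2⟩ := hvI x hx.1.2
      have hvm : v x ∈ Icc (-1 : ℝ) 1 := ⟨hl.trans hv1, hv2.trans (h.mem_Icc x).2⟩
      rw [← ENNReal.ofReal_add (hB.nonneg hlam (h.mem_Icc x) x) (by positivity)]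
      refine ENNReal.ofReal_le_ofReal ?_
      have h1 := (hA (H x) _ x hvm).2
      -- For `u x ≤ σ ≤ 0` lowering the value does not raise `W`; above `σ` the crude bound `W ≤
      -- lam` is paid, which produces the indicator term.
      have h2 : W (v x) x ≤ W (u x) x + lam * (if σ < u x then 1 else 0) := by
        split_ifs with hσu
        · have := hB.le hm hlam hvm x
          have := hB.nonneg hlam (h.mem_Icc x) x
          linarith
        · have := (not_lt.mp hσu).trans hσ
          rw [mul_zero, add_zero]
          exact (hC x).1 ⟨hvm.1, hv2.trans this⟩ ⟨(h.mem_Icc x).1, this⟩ hv2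
      linarith
    · exact ((((hGm.sub (measurable_truncationGradient hum hGm)).norm.pow_const p).add
        (Measurable.ite mσ measurable_const measurable_const)).const_mul _).ennreal_ofReal
  have hvolAs := volume_superlevel_ne_top u l s
  have hvolN : volume (At \ As) ≠ ⊤ :=
    ne_top_of_le_ne_top (volume_superlevel_ne_top u l t) (measure_mono sdiff_subset)
  have f1 : ∫⁻ x in As, ENNReal.ofReal (W l x) ≠ ⊤ :=
    lintegral_superlevel_ofReal_ne_top (fun x => hB.le hm hlam l1 x) _ hvolAs
  have f2 : ∫⁻ x in At \ As, ENNReal.ofReal (W (u x) x) ≠ ⊤ :=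
    lintegral_superlevel_ofReal_ne_top (fun x => hB.le hm hlam (h.mem_Icc x) x) _ hvolN
  -- The integrals of `W l` over the inner set and of `W u` over the annulus occur on both sides and
  -- are finite, so they cancel.
  have hfinal := (add_le_add hlow1 hlow2).trans (hcmp.trans (add_le_add hup1.le hup2))
  rw [add_assoc, ENNReal.add_le_add_iff_left f1, add_comm, ENNReal.add_le_add_iff_left f2] at hfinal
  exact hfinal

/-- The integrand `|∇u|ᵖ + 1_{u > σ}` of the Caccioppoli inequality. -/
noncomputable def caccioppoliDensity (p σ : ℝ) (u : EuclideanSpace ℝ (Fin n) → ℝ)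
    (G : EuclideanSpace ℝ (Fin n) → EuclideanSpace ℝ (Fin n)) (x : EuclideanSpace ℝ (Fin n)) : ℝ :=
  ‖G x‖ ^ p + if σ < u x then 1 else 0

/-- The constant of the Caccioppoli inequality before hole filling. -/
noncomputable def holeFillingConst (p lam c : ℝ) : ℝ :=
  (min lam⁻¹ c)⁻¹ * (lam * (2 ^ p * (2 ^ p + (4 * smoothTransitionDerivBound) ^ p)))

theorem holeFillingConst_nonneg (hlam : 0 < lam) (hc : 0 < c) : 0 ≤ holeFillingConst p lam c := by
  have := smoothTransitionDerivBound_nonneg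
  have : 0 < min lam⁻¹ c := lt_min (inv_pos.mpr hlam) hc
  unfold holeFillingConst
  positivity

theorem add_rpow_le_two_rpow_mul {x y : ℝ} (hx : 0 ≤ x) (hy : 0 ≤ y) (hp : 0 ≤ p) :
    (x + y) ^ p ≤ 2 ^ p * (x ^ p + y ^ p) := by
  have h1 : (x + y) ^ p ≤ (2 * max x y) ^ p := by
    refine Real.rpow_le_rpow (by positivity) ?_ hp
    linarith [le_max_left x y, le_max_right x y]
  rw [Real.mul_rpow (by norm_num) (by positivity)] at h1
  refine h1.trans (mul_le_mul_of_nonneg_left ?_ (by positivity))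
  have := Real.rpow_nonneg hx p
  have := Real.rpow_nonneg hy p
  rcases max_choice x y with h | h <;> rw [h] <;> linarith

/-- Putting one and the same density on both sides, over the inner set and over the annulus,
prepares hole filling. The triangle inequality bounds the competitor's gradient by `2 ‖G‖` plus a
multiple of `(t - s)⁻¹`. -/
theorem IsMeasurableMinimizer.lintegral_caccioppoliDensity_le
    (h : IsMeasurableMinimizer p F W Ω u G)
    (hA : AssumptionA p lam F) (hB : AssumptionB m lam W) (hC : AssumptionC W) (hp : 1 < p)
    (hm : 0 ≤ m) (hlam : 0 < lam) (hΩ : Metric.ball 0 ρ ⊆ Ω) (hl : -1 ≤ l) (hlσ : l ≤ σ)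
    (hσ : σ ≤ 0) (hub : ∀ᵐ x ∂(volume.restrict (Metric.ball 0 ρ)), u x ≤ b)
    (hc : 0 < c) (hgap : ∀ x, ∀ τ, σ < τ → τ ≤ b → W l x + c ≤ W τ x)
    (hs : 0 < s) (hst : s < t) (ht : t < ρ) :
    ∫⁻ x in superlevel u l s, ENNReal.ofReal (caccioppoliDensity p σ u G x)
      ≤ ENNReal.ofReal (holeFillingConst p lam c) *
        ((∫⁻ x in superlevel u l t \ superlevel u l s,
          ENNReal.ofReal (caccioppoliDensity p σ u G x))
          + ENNReal.ofReal ((t - s)⁻¹ ^ p) * volume (superlevel u l t)) := by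
  have key := h.lintegral_superlevel_le hA hB hC hp hm hlam hΩ hl hlσ hσ hub hc.le hgap hs hst ht
  set N := superlevel u l t \ superlevel u l s with hN
  have mN : MeasurableSet N := (measurableSet_superlevel h.measurable l t).diff
    (measurableSet_superlevel h.measurable l s)
  set k := min lam⁻¹ c with hk
  set M := smoothTransitionDerivBound with hM
  have hM0 : 0 ≤ M := smoothTransitionDerivBound_nonneg
  have hk0 : 0 < k := lt_min (inv_pos.mpr hlam) hc
  have hd : 0 < (t - s)⁻¹ := inv_pos.mpr (sub_pos.mpr hst)
  set K := lam * (2 ^ p * (2 ^ p + (4 * M) ^ p)) with hK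
  have hK0 : 0 ≤ K := by positivity
  have hKe : holeFillingConst p lam c = k⁻¹ * K := rfl
  have hlow : ENNReal.ofReal k * ∫⁻ x in superlevel u l s,
      ENNReal.ofReal (caccioppoliDensity p σ u G x) ≤ ∫⁻ x in superlevel u l s,
        ENNReal.ofReal (lam⁻¹ * ‖G x‖ ^ p + if σ < u x then c else 0) := by
    rw [← lintegral_const_mul' _ _ ENNReal.ofReal_ne_top]
    refine lintegral_mono fun x => ?_
    rw [← ENNReal.ofReal_mul hk0.le]
    refine ENNReal.ofReal_le_ofReal ?_
    rw [caccioppoliDensity, mul_add]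
    refine add_le_add (mul_le_mul_of_nonneg_right (min_le_left _ _) (by positivity)) ?_
    split_ifs
    · rw [mul_one]
      exact min_le_right _ _
    · simp
  have hup : ∫⁻ x in N, ENNReal.ofReal
      (lam * (‖G x - truncationGradient l s t u G x‖ ^ p + if σ < u x then 1 else 0))
      ≤ ENNReal.ofReal K * ((∫⁻ x in N, ENNReal.ofReal (caccioppoliDensity p σ u G x))
          + ENNReal.ofReal ((t - s)⁻¹ ^ p) * volume (superlevel u l t)) := by
    calc _ ≤ ∫⁻ x in N, ENNReal.ofReal K * (ENNReal.ofReal (caccioppoliDensity p σ u G x)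
          + ENNReal.ofReal ((t - s)⁻¹ ^ p)) := by
          refine lintegral_mono fun x => ?_
          have hd0 : 0 ≤ caccioppoliDensity p σ u G x := by
            unfold caccioppoliDensity
            positivity
          rw [← ENNReal.ofReal_add hd0 (by positivity), ← ENNReal.ofReal_mul hK0]
          refine ENNReal.ofReal_le_ofReal ?_
          have h1 : ‖G x - truncationGradient l s t u G x‖ ≤ 2 * ‖G x‖ + 4 * M * (t - s)⁻¹ := by
            have := norm_truncationGradient_le (G := G) (h.mem_Icc x).2 hl hs hst
            have := norm_sub_le (G x) (truncationGradient l s t u G x)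
            rw [div_eq_mul_inv] at *
            linarith
          have h2 := (Real.rpow_le_rpow (norm_nonneg _) h1 (by linarith : (0 : ℝ) ≤ p)).trans
            (add_rpow_le_two_rpow_mul (by positivity) (by positivity) (by linarith))
          rw [Real.mul_rpow (by norm_num) (norm_nonneg _),
            Real.mul_rpow (by positivity) hd.le] at h2
          rw [hK, mul_assoc, mul_assoc, caccioppoliDensity]
          refine mul_le_mul_of_nonneg_left ?_ hlam.le
          have ha : (1 : ℝ) ≤ 2 ^ p := Real.one_le_rpow (by norm_num) (by linarith)
          have hM4 : 0 ≤ (4 * M) ^ p := by positivity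
          have hg : 0 ≤ ‖G x‖ ^ p := by positivity
          have hτ : 0 ≤ (t - s)⁻¹ ^ p := by positivity
          have hi : (0 : ℝ) ≤ if σ < u x then 1 else 0 := by positivity
          generalize (if σ < u x then (1 : ℝ) else 0) = i at *
          have ha0 : (0 : ℝ) ≤ 2 ^ p := by linarith
          have hi1 : i ≤ (2 : ℝ) ^ p * (2 ^ p * i) := by
            nlinarith [mul_le_mul_of_nonneg_right ha hi,
              mul_le_mul_of_nonneg_left (mul_le_mul_of_nonneg_right ha hi) ha0]
          have hi2 : 0 ≤ (2 : ℝ) ^ p * ((4 * M) ^ p * (‖G x‖ ^ p + i) + 2 ^ p * (t - s)⁻¹ ^ p) := by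
            positivity
          nlinarith
      _ = ENNReal.ofReal K * ((∫⁻ x in N, ENNReal.ofReal (caccioppoliDensity p σ u G x))
          + ENNReal.ofReal ((t - s)⁻¹ ^ p) * volume N) := by
          rw [lintegral_const_mul' _ _ ENNReal.ofReal_ne_top,
            lintegral_add_right _ measurable_const, setLIntegral_const]
      _ ≤ _ := by
          gcongr
          exact sdiff_subset
  have hall := hlow.trans (key.trans hup)
  rw [hKe, ENNReal.ofReal_mul (inv_nonneg.mpr hk0.le), mul_assoc, ENNReal.ofReal_inv_of_pos hk0]
  rwa [← ENNReal.mul_le_iff_le_inv (by simpa using hk0) ENNReal.ofReal_ne_top]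

theorem caccioppoliDensity_nonneg (x : EuclideanSpace ℝ (Fin n)) :
    0 ≤ caccioppoliDensity p σ u G x := by
  unfold caccioppoliDensity
  positivity

theorem MemW1pLoc.integrableOn_caccioppoliDensity (h : MemW1pLoc p Ω u G) (hu : Measurable u)
    (hp : 1 < p) (hΩ : Metric.ball 0 ρ ⊆ Ω) (hs : s < ρ) :
    IntegrableOn (caccioppoliDensity p σ u G) (superlevel u l s) := by
  have hfin : IsFiniteMeasure (volume.restrict (superlevel u l s)) :=
    isFiniteMeasure_restrict.mpr (volume_superlevel_ne_top u l s)
  refine Integrable.add ?_ ?_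
  · exact (h.integrableOn_norm_rpow hp (isCompact_closedBall 0 s)
      ((Metric.closedBall_subset_ball hs).trans hΩ)).mono_set
      ((superlevel_subset_ball u l s).trans Metric.ball_subset_closedBall)
  · refine Integrable.of_bound (Measurable.ite (measurableSet_lt measurable_const hu)
      measurable_const measurable_const).aestronglyMeasurable 1 (Eventually.of_forall fun x => ?_)
    split_ifs <;> simp

/-- Local integrability of the density allows the annulus integral to be written as a difference, so
that part of it can be moved to the left side. -/
theorem IsMeasurableMinimizer.setIntegral_caccioppoliDensity_le
    (h : IsMeasurableMinimizer p F W Ω u G)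
    (hA : AssumptionA p lam F) (hB : AssumptionB m lam W) (hC : AssumptionC W) (hp : 1 < p)
    (hm : 0 ≤ m) (hlam : 0 < lam) (hΩ : Metric.ball 0 ρ ⊆ Ω) (hl : -1 ≤ l) (hlσ : l ≤ σ)
    (hσ : σ ≤ 0) (hub : ∀ᵐ x ∂(volume.restrict (Metric.ball 0 ρ)), u x ≤ b)
    (hc : 0 < c) (hgap : ∀ x, ∀ τ, σ < τ → τ ≤ b → W l x + c ≤ W τ x)
    (hs : 0 < s) (hst : s < t) (ht : t < ρ) :
    ∫ x in superlevel u l s, caccioppoliDensity p σ u G x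
      ≤ holeFillingConst p lam c * ((∫ x in superlevel u l t, caccioppoliDensity p σ u G x)
        - (∫ x in superlevel u l s, caccioppoliDensity p σ u G x)
          + (t - s)⁻¹ ^ p * volume.real (superlevel u l t)) := by
  have key := h.lintegral_caccioppoliDensity_le hA hB hC hp hm hlam hΩ hl hlσ hσ hub hc hgap
    hs hst ht
  have iT := h.memW1pLoc.integrableOn_caccioppoliDensity (σ := σ) (l := l) h.measurable hp hΩ ht
  have iS := h.memW1pLoc.integrableOn_caccioppoliDensity (σ := σ) (l := l) h.measurable hp hΩ
    (hst.trans ht)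
  have hsub : superlevel u l s ⊆ superlevel u l t := superlevel_mono u le_rfl hst.le
  have hd : 0 < (t - s)⁻¹ := inv_pos.mpr (sub_pos.mpr hst)
  have hK := holeFillingConst_nonneg (p := p) hlam hc
  have hnn : ∀ N : Set (EuclideanSpace ℝ (Fin n)),
      0 ≤ᵐ[volume.restrict N] caccioppoliDensity p σ u G :=
    fun N => Eventually.of_forall fun x => caccioppoliDensity_nonneg x
  rw [← setIntegral_sdiff (measurableSet_superlevel h.measurable l s) iT hsub]
  rw [← ofReal_integral_eq_lintegral_ofReal iS (hnn _),
    ← ofReal_integral_eq_lintegral_ofReal (iT.mono_set sdiff_subset) (hnn _),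
    ← ofReal_measureReal (volume_superlevel_ne_top u l t), ← ENNReal.ofReal_mul (by positivity),
    ← ENNReal.ofReal_add (integral_nonneg fun x => caccioppoliDensity_nonneg x) (by positivity),
    ← ENNReal.ofReal_mul hK] at key
  refine (ENNReal.ofReal_le_ofReal_iff (mul_nonneg hK (add_nonneg
    (integral_nonneg fun x => caccioppoliDensity_nonneg x) (by positivity)))).mp key

/-- The hole filling iteration lemma. -/
theorem exists_hole_filling_const {θ p : ℝ} (hθ : 0 ≤ θ) (hθ1 : θ < 1) (hp : 0 < p) :
    ∃ C : ℝ, 0 ≤ C ∧ ∀ (f : ℝ → ℝ) (s t A B : ℝ), s < t → 0 ≤ A →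
      (∀ r, r ≤ t → f r ≤ B) →
      (∀ r r', s ≤ r → r < r' → r' ≤ t → f r ≤ θ * f r' + A * (r' - r)⁻¹ ^ p) →
      f s ≤ C * (A * (t - s)⁻¹ ^ p) := by
  -- With `a ^ p = (1 + θ) / 2` strictly between `θ` and `1`, the radii `t - a ^ i (t - s)` increase
  -- from `s` towards `t`, and the error terms still sum, since each step multiplies them by `γ = θ
  -- a⁻ᵖ < 1`.
  set a := ((1 + θ) / 2) ^ p⁻¹ with ha
  have ha0 : 0 < a := by positivity
  have hap : a ^ p = (1 + θ) / 2 := by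
    rw [ha, ← Real.rpow_mul (by positivity), inv_mul_cancel₀ hp.ne', Real.rpow_one]
  have ha1 : a < 1 := Real.rpow_lt_one (by positivity) (by linarith) (inv_pos.mpr hp)
  set γ := θ * a⁻¹ ^ p with hγ
  have hγ0 : 0 ≤ γ := by positivity
  have hγ1 : γ < 1 := by
    rw [hγ, Real.inv_rpow ha0.le, hap, ← div_eq_mul_inv, div_lt_one (by linarith)]
    linarith
  have h1a : 0 < (1 - a)⁻¹ := inv_pos.mpr (by linarith)
  have h1γ : 0 < (1 - γ)⁻¹ := inv_pos.mpr (by linarith)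
  refine ⟨(1 - a)⁻¹ ^ p * (1 - γ)⁻¹, by positivity, fun f s t A B hst hA hB hf => ?_⟩
  have hd : 0 < t - s := sub_pos.mpr hst
  set A' := A * ((1 - a)⁻¹ ^ p * (t - s)⁻¹ ^ p) with hA'
  have hA'0 : 0 ≤ A' := by positivity
  have hstep : ∀ i : ℕ, f (t - a ^ i * (t - s))
      ≤ θ * f (t - a ^ (i + 1) * (t - s)) + A' * (a⁻¹ ^ p) ^ i := by
    intro i
    have hai : 0 < a ^ i := pow_pos ha0 i
    have hai1 : a ^ i ≤ 1 := pow_le_one₀ ha0.le ha1.le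
    have := hf (t - a ^ i * (t - s)) (t - a ^ (i + 1) * (t - s)) (by nlinarith)
      (by rw [pow_succ]; nlinarith [mul_pos hai hd]) (by
        have : 0 < a ^ (i + 1) * (t - s) := by positivity
        linarith)
    refine this.trans (le_of_eq ?_)
    have e : (t - a ^ (i + 1) * (t - s) - (t - a ^ i * (t - s)))⁻¹
        = (1 - a)⁻¹ * (t - s)⁻¹ * a⁻¹ ^ i := by
      rw [inv_pow, ← mul_inv, ← mul_inv]
      congr 1
      ring
    rw [e, Real.mul_rpow (by positivity) (by positivity), Real.mul_rpow h1a.le (by positivity),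
      ← Real.rpow_pow_comm (inv_nonneg.mpr ha0.le), hA']
    ring
  have hiter : ∀ i : ℕ, f s ≤ θ ^ i * f (t - a ^ i * (t - s))
      + A' * ∑ j ∈ Finset.range i, γ ^ j := by
    intro i
    induction i with
    | zero => simp
    | succ i ih =>
      refine ih.trans ?_
      have := mul_le_mul_of_nonneg_left (hstep i) (pow_nonneg hθ i)
      rw [Finset.sum_range_succ, hγ, mul_pow, pow_succ]
      nlinarith
  have hbd : ∀ i : ℕ, f s ≤ θ ^ i * B + A' * (1 - γ)⁻¹ := by
    intro i
    refine (hiter i).trans (add_le_add ?_ ?_)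
    · refine mul_le_mul_of_nonneg_left (hB _ ?_) (pow_nonneg hθ i)
      have : 0 < a ^ i * (t - s) := by positivity
      linarith
    · refine mul_le_mul_of_nonneg_left ?_ hA'0
      rw [← tsum_geometric_of_lt_one hγ0 hγ1]
      exact (summable_geometric_of_lt_one hγ0 hγ1).sum_le_tsum _ (fun j _ => pow_nonneg hγ0 j)
  -- The a priori bound `B` is multiplied by `θ ^ i` and disappears in the limit, so it does not
  -- enter the constant.
  have hlim : Tendsto (fun i : ℕ => θ ^ i * B + A' * (1 - γ)⁻¹) atTop
      (𝓝 (0 * B + A' * (1 - γ)⁻¹)) :=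
    ((tendsto_pow_atTop_nhds_zero_of_lt_one hθ hθ1).mul_const B).add_const _
  refine (ge_of_tendsto' hlim hbd).trans (le_of_eq ?_)
  rw [hA']
  ring

end Caccioppoli

/-- The Caccioppoli inequality for minimizers on superlevel sets. -/
theorem exists_caccioppoli_const {p lam c : ℝ} (hp : 1 < p) (hlam : 0 < lam) (hc : 0 < c) :
    ∃ K : ℝ, 0 ≤ K ∧ ∀ (n : ℕ) (m ρ l σ b s t : ℝ)
      (F : EuclideanSpace ℝ (Fin n) → ℝ → EuclideanSpace ℝ (Fin n) → ℝ)
      (W : ℝ → EuclideanSpace ℝ (Fin n) → ℝ) (Ω : Set (EuclideanSpace ℝ (Fin n)))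
      (u : EuclideanSpace ℝ (Fin n) → ℝ)
      (G : EuclideanSpace ℝ (Fin n) → EuclideanSpace ℝ (Fin n)),
      IsMeasurableMinimizer p F W Ω u G → AssumptionA p lam F → AssumptionB m lam W →
      AssumptionC W → 0 ≤ m → Metric.ball 0 ρ ⊆ Ω → -1 ≤ l → l ≤ σ → σ ≤ 0 →
      (∀ᵐ x ∂(volume.restrict (Metric.ball 0 ρ)), u x ≤ b) →
      (∀ x, ∀ τ, σ < τ → τ ≤ b → W l x + c ≤ W τ x) → 0 < s → s < t → t < ρ →
      ∫ x in superlevel u l s, caccioppoliDensity p σ u G x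
        ≤ K * ((t - s)⁻¹ ^ p * volume.real (superlevel u l t)) := by
  set k := holeFillingConst p lam c with hk
  have hk0 : 0 ≤ k := holeFillingConst_nonneg hlam hc
  -- Adding `k` times the inner integral to both sides of the comparison gives the contraction
  -- factor `k / (1 + k) < 1`.
  obtain ⟨C, hC0, hC⟩ := exists_hole_filling_const (θ := k / (1 + k)) (by positivity)
    (by rw [div_lt_one (by linarith)]; linarith) (by linarith : 0 < p)
  refine ⟨C, hC0, fun n m ρ l σ b s t F W Ω u G h hA hB hCc hm hΩ hl hlσ hσ hub hgap hs hst ht =>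
    ?_⟩
  have hmono : ∀ r, r ≤ t → ∫ x in superlevel u l r, caccioppoliDensity p σ u G x
      ≤ ∫ x in superlevel u l t, caccioppoliDensity p σ u G x := fun r hr =>
    setIntegral_mono_set (h.memW1pLoc.integrableOn_caccioppoliDensity h.measurable hp hΩ ht)
      (Eventually.of_forall fun x => caccioppoliDensity_nonneg x)
      (superlevel_mono u le_rfl hr).eventuallyLE
  refine (hC (fun r => ∫ x in superlevel u l r, caccioppoliDensity p σ u G x) s t
    (volume.real (superlevel u l t)) _ hst measureReal_nonneg hmono
    fun r r' hr hrr hr' => ?_).trans (le_of_eq (by ring))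
  have hkey := h.setIntegral_caccioppoliDensity_le hA hB hCc hp hm hlam hΩ hl hlσ hσ hub hc hgap
    (hs.trans_le hr) hrr (hr'.trans_lt ht)
  rw [← hk] at hkey
  have hV : volume.real (superlevel u l r') ≤ volume.real (superlevel u l t) :=
    measureReal_mono (superlevel_mono u le_rfl hr') (volume_superlevel_ne_top u l t)
  have hd : 0 < (r' - r)⁻¹ := inv_pos.mpr (sub_pos.mpr hrr)
  have hdV := mul_le_mul_of_nonneg_left hV (by positivity : 0 ≤ (r' - r)⁻¹ ^ p)
  have hT : 0 ≤ (r' - r)⁻¹ ^ p * volume.real (superlevel u l t) := by positivity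
  have h1k : 0 < 1 + k := by linarith
  refine le_of_mul_le_mul_left ?_ h1k
  have e : (1 + k) * (k / (1 + k) * (∫ x in superlevel u l r', caccioppoliDensity p σ u G x)
      + volume.real (superlevel u l t) * (r' - r)⁻¹ ^ p)
      = k * (∫ x in superlevel u l r', caccioppoliDensity p σ u G x)
        + (1 + k) * ((r' - r)⁻¹ ^ p * volume.real (superlevel u l t)) := by
    field_simp
  rw [e]
  nlinarith [mul_le_mul_of_nonneg_left hdV hk0]

/-! ### The De Giorgi step and the iteration lemma. -/

/-- The De Giorgi step: the volume of a superlevel set is controlled by a superlinear power of the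
volume of a larger superlevel set. -/
theorem exists_volume_superlevel_le {n : ℕ} (hn : 2 ≤ n) {p lam c : ℝ} (hp : 1 < p)
    (hlam : 0 < lam) (hc : 0 < c) :
    ∃ C : ℝ, 0 < C ∧ ∀ (m ρ l l' b s t : ℝ)
      (F : EuclideanSpace ℝ (Fin n) → ℝ → EuclideanSpace ℝ (Fin n) → ℝ)
      (W : ℝ → EuclideanSpace ℝ (Fin n) → ℝ) (Ω : Set (EuclideanSpace ℝ (Fin n)))
      (u : EuclideanSpace ℝ (Fin n) → ℝ)
      (G : EuclideanSpace ℝ (Fin n) → EuclideanSpace ℝ (Fin n)),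
      IsMeasurableMinimizer p F W Ω u G → AssumptionA p lam F → AssumptionB m lam W →
      AssumptionC W → 0 ≤ m → Metric.ball 0 ρ ⊆ Ω → -1 ≤ l → l ≤ 0 → l < l' →
      (∀ᵐ x ∂(volume.restrict (Metric.ball 0 ρ)), u x ≤ b) →
      (∀ x, ∀ τ, 0 < τ → τ ≤ b → W l x + c ≤ W τ x) → 0 < s → s < t → t < ρ →
      volume.real (superlevel u l' s)
        ≤ (C * (volume.real (superlevel u l t) / ((t - s) * (l' - l))))
          ^ ((n : ℝ) / ((n : ℝ) - 1)) := by
  obtain ⟨S, hS⟩ := exists_lintegral_pow_le_of_isWeakGradient hn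
  obtain ⟨K, hK0, hK⟩ := exists_caccioppoli_const hp hlam hc
  set q := (n : ℝ) / ((n : ℝ) - 1) with hq
  have hn1 : (1 : ℝ) < n := by exact_mod_cast hn
  have hq0 : 0 < q := div_pos (by linarith) (by linarith)
  set M := smoothTransitionDerivBound with hM
  have hM0 : 0 ≤ M := smoothTransitionDerivBound_nonneg
  -- The terms come from `y ≤ 1 + y ^ p`, from the gradient of a cutoff on an annulus of width `d /
  -- 3`, and from the Caccioppoli inequality on another annulus of that width.
  set N := 1 + 12 * M + K * 3 ^ p with hN
  have hN0 : 0 < N := by positivity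
  refine ⟨((S : ℝ) + 1) ^ q⁻¹ * N, by positivity, fun m ρ l l' b s t F W Ω u G h hA hB hCc hm hΩ hl
    hl0 hll hub hgap hs hst ht => ?_⟩
  have hd : 0 < t - s := sub_pos.mpr hst
  set d := t - s with hdd
  -- The annulus is cut into thirds. The cutoff decreases on the first and Caccioppoli is applied
  -- across the last; the middle one places the closed ball of radius `r` inside the open ball of
  -- radius `r'`.
  set r := s + d / 3 with hr
  set r' := s + 2 * d / 3 with hr'
  have hsr : s < r := by linarith
  have hrr : r < r' := by linarith
  have hrt : r' < t := by linarith
  have hu := h.measurable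
  have hsob := hS (truncation l s r u) (truncationGradient l s r u G)
  have hcac := hK n m ρ l 0 b r' t F W Ω u G h hA hB hCc hm hΩ hl hl0 le_rfl hub hgap
    (by linarith) hrt ht
  have hcs : HasCompactSupport (truncation l s r u) :=
    (hasCompactSupport_radialCutoff hs hsr).mul_right
  have hw := isWeakGradient_truncation (l := l) hu hp h.memW1pLoc hΩ hs hsr (by linarith)
  have hb2 : ∀ x, ‖truncation l s r u x‖ ≤ 2 := fun x => by
    rw [Real.norm_eq_abs, abs_of_nonneg (truncation_nonneg x)]
    exact (truncation_le x).trans (max_le (by linarith [(h.mem_Icc x).2]) (by norm_num))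
  have hi : Integrable (truncation l s r u) := by
    rw [← integrableOn_iff_integrable_of_support_subset (subset_tsupport _)]
    have : IsFiniteMeasure (volume.restrict (tsupport (truncation l s r u))) :=
      isFiniteMeasure_restrict.mpr hcs.isCompact.measure_ne_top
    exact Integrable.of_bound (measurable_truncation hu).aestronglyMeasurable 2
      (Eventually.of_forall hb2)
  set V := volume.real (superlevel u l t) with hV
  have hVr : volume.real (superlevel u l r') ≤ V :=
    measureReal_mono (superlevel_mono u le_rfl hrt.le) (volume_superlevel_ne_top u l t)
  have mA : MeasurableSet (superlevel u l r') := measurableSet_superlevel hu l r'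
  have ie := h.memW1pLoc.integrableOn_caccioppoliDensity (σ := 0) (l := l) hu hp hΩ
    (hrt.trans ht)
  have ibound : IntegrableOn (fun x => d⁻¹ * ((1 + 12 * M) + d ^ p * caccioppoliDensity p 0 u G x))
      (superlevel u l r') :=
    ((integrableOn_const (volume_superlevel_ne_top u l r')).add (ie.const_mul _)).const_mul _
  have hgb : ∀ x, ‖truncationGradient l s r u G x‖ ≤ (superlevel u l r').indicator
      (fun x => d⁻¹ * ((1 + 12 * M) + d ^ p * caccioppoliDensity p 0 u G x)) x := by
    intro x
    by_cases hx : x ∈ superlevel u l r'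
    · rw [indicator_of_mem hx]
      have h1 := norm_truncationGradient_le (G := G) (h.mem_Icc x).2 hl hs hsr
      have h2 : 4 * M / (r - s) = d⁻¹ * (12 * M) := by
        rw [hr, add_sub_cancel_left, div_div_eq_mul_div]
        ring
      rw [← hM, h2] at h1
      -- This turns the `L^p` gradient bound into an `L¹` bound. The factor `d` matches the factor
      -- `d⁻ᵖ` of Caccioppoli, so the result is homogeneous in `d`.
      have h3 : d * ‖G x‖ ≤ 1 + d ^ p * ‖G x‖ ^ p := by
        rw [← Real.mul_rpow hd.le (norm_nonneg _)]
        rcases le_total (d * ‖G x‖) 1 with h0 | h0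
        · have : 0 ≤ (d * ‖G x‖) ^ p := by positivity
          linarith
        · have := Real.self_le_rpow_of_one_le h0 hp.le
          linarith
      have h4 : ‖G x‖ ^ p ≤ caccioppoliDensity p 0 u G x := by
        rw [caccioppoliDensity]
        exact le_add_of_nonneg_right (by positivity)
      have h5 := mul_le_mul_of_nonneg_left h4 (by positivity : 0 ≤ d ^ p)
      have h6 : ‖G x‖ ≤ d⁻¹ * (1 + d ^ p * caccioppoliDensity p 0 u G x) := by
        rw [le_inv_mul_iff₀ hd]
        linarith
      refine h1.trans ((add_le_add h6 le_rfl).trans (le_of_eq ?_))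
      ring
    · rw [indicator_of_notMem hx, truncationGradient_eq_zero hs hsr, norm_zero]
      by_contra hcon
      push Not at hcon
      exact hx ⟨hcon.2.trans_lt hrr, hcon.1⟩
  have ibound' := (integrable_indicator_iff mA).mpr ibound
  have hiG : Integrable (truncationGradient l s r u G) :=
    ibound'.mono' (measurable_truncationGradient hu h.measurable_gradient).aestronglyMeasurable
      (Eventually.of_forall hgb)
  have hgrad : ∫⁻ x, ‖truncationGradient l s r u G x‖ₑ ≤ ENNReal.ofReal (N * (V / d)) := by
    rw [← ofReal_integral_norm_eq_lintegral_enorm hiG]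
    refine ENNReal.ofReal_le_ofReal ((integral_mono hiG.norm ibound' hgb).trans ?_)
    have ic : IntegrableOn (fun _ => 1 + 12 * M) (superlevel u l r') :=
      integrableOn_const (volume_superlevel_ne_top u l r')
    rw [integral_indicator mA, integral_const_mul, integral_add ic (ie.const_mul _),
      integral_const_mul,
      setIntegral_const, smul_eq_mul]
    have h1 : d ^ p * (t - r')⁻¹ ^ p = 3 ^ p := by
      have : t - r' = d / 3 := by rw [hr']; linarith
      rw [this, ← Real.mul_rpow hd.le (by positivity)]
      congr 1
      have := hd.ne'
      field_simp
    have h2 := mul_le_mul_of_nonneg_left hcac (by positivity : 0 ≤ d ^ p)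
    have h3 : d ^ p * (K * ((t - r')⁻¹ ^ p * V)) = K * 3 ^ p * V := by
      rw [← h1]
      ring
    rw [h3] at h2
    have h4 : volume.real (superlevel u l r') * (1 + 12 * M) ≤ V * (1 + 12 * M) :=
      mul_le_mul_of_nonneg_right hVr (by positivity)
    calc _ ≤ d⁻¹ * (V * (1 + 12 * M) + K * 3 ^ p * V) := by gcongr
      _ = N * (V / d) := by
        rw [hN]
        ring
  have hδ : 0 < l' - l := sub_pos.mpr hll
  -- Chebyshev's inequality: on the smaller superlevel set the cutoff is `1` and the truncation
  -- exceeds `l' - l`.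
  have hlow : ENNReal.ofReal ((l' - l) ^ q * volume.real (superlevel u l' s))
      ≤ ∫⁻ x, ‖truncation l s r u x‖ₑ ^ q := by
    rw [ENNReal.ofReal_mul (by positivity), ofReal_measureReal (volume_superlevel_ne_top u l' s),
      ← setLIntegral_const]
    refine le_trans (setLIntegral_mono' (measurableSet_superlevel hu l' s) fun x hx => ?_)
      (setLIntegral_le_lintegral (superlevel u l' s) _)
    rw [← ENNReal.ofReal_rpow_of_pos hδ]
    refine ENNReal.rpow_le_rpow ?_ hq0.le
    rw [← ofReal_norm]
    refine ENNReal.ofReal_le_ofReal (le_trans ?_ (le_abs_self _))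
    rw [truncation, radialCutoff_eq_one hs hsr hx.1.le, one_mul]
    exact le_trans (by linarith [hx.2]) (le_max_left _ _)
  have hVd : 0 ≤ N * (V / d) := mul_nonneg hN0.le (div_nonneg measureReal_nonneg hd.le)
  have hfin : (l' - l) ^ q * volume.real (superlevel u l' s) ≤ (S + 1) * (N * (V / d)) ^ q := by
    have h1 := hlow.trans ((hsob hi hiG hcs hw).trans
      (mul_le_mul' le_rfl (ENNReal.rpow_le_rpow hgrad hq0.le)))
    rw [ENNReal.ofReal_rpow_of_nonneg hVd hq0.le, ← ENNReal.ofReal_coe_nnreal,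
      ← ENNReal.ofReal_mul S.coe_nonneg, ENNReal.ofReal_le_ofReal_iff (by positivity)] at h1
    refine h1.trans (mul_le_mul_of_nonneg_right (by linarith) (by positivity))
  have he : (S + 1) ^ q⁻¹ * N * (V / (d * (l' - l))) = ((S : ℝ) + 1) ^ q⁻¹ * (N * (V / d))
      * (l' - l)⁻¹ := by
    rw [div_mul_eq_div_div, div_eq_mul_inv (V / d)]
    ring
  rw [he, Real.mul_rpow (by positivity) (by positivity), Real.mul_rpow (by positivity) hVd,
    ← Real.rpow_mul (by positivity), inv_mul_cancel₀ hq0.ne', Real.rpow_one,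
    Real.inv_rpow hδ.le, ← div_eq_mul_inv, le_div_iff₀ (by positivity), mul_comm]
  exact hfin

/-- De Giorgi's iteration lemma on fast geometric convergence. -/
theorem exists_pos_tendsto_zero_of_superlinear {B q : ℝ} (hB : 0 < B) (hq : 1 < q) :
    ∃ ε : ℝ, 0 < ε ∧ ∀ a : ℕ → ℝ, (∀ j, 0 ≤ a j) → (∀ j, a (j + 1) ≤ (B * 4 ^ j * a j) ^ q) →
      a 0 ≤ ε → Tendsto a atTop (𝓝 0) := by
  have hq1 : 0 < q - 1 := by linarith
  have hq0 : 0 < q := by linarith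
  -- `μ` and `ε` solve `(4 μ) ^ q = μ` and `(B ε) ^ q = ε μ`, so the bound `a j ≤ ε μ ^ j`
  -- reproduces itself under the recursion.
  set μ : ℝ := (4 ^ q)⁻¹ ^ (q - 1)⁻¹ with hμ
  have hμ0 : 0 < μ := by positivity
  have hμ1 : μ < 1 := Real.rpow_lt_one (by positivity)
    (inv_lt_one_of_one_lt₀ (Real.one_lt_rpow (by norm_num) hq0)) (inv_pos.mpr hq1)
  have hμq : μ ^ (q - 1) = (4 ^ q)⁻¹ := by
    rw [hμ, ← Real.rpow_mul (by positivity), inv_mul_cancel₀ hq1.ne', Real.rpow_one]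
  set ε : ℝ := (μ / B ^ q) ^ (q - 1)⁻¹ with hε
  have hε0 : 0 < ε := by positivity
  have hεq : ε ^ (q - 1) = μ / B ^ q := by
    rw [hε, ← Real.rpow_mul (by positivity), inv_mul_cancel₀ hq1.ne', Real.rpow_one]
  have hsplit : ∀ x : ℝ, 0 < x → x ^ q = x ^ (q - 1) * x := fun x hx => by
    rw [Real.rpow_sub_one hx.ne', div_mul_cancel₀ _ hx.ne']
  refine ⟨ε, hε0, fun a ha0 ha hε' => ?_⟩
  have key : ∀ j, a j ≤ ε * μ ^ j := by
    intro j
    induction j with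
    | zero => simpa using hε'
    | succ j ih =>
      have hBj : 0 ≤ B * 4 ^ j := by positivity
      refine (ha j).trans ((Real.rpow_le_rpow (mul_nonneg hBj (ha0 j))
        (mul_le_mul_of_nonneg_left ih hBj) hq0.le).trans (le_of_eq ?_))
      have e1 : B * 4 ^ j * (ε * μ ^ j) = B * ε * (4 * μ) ^ j := by
        rw [mul_pow]
        ring
      have e2 : (4 * μ) ^ q = μ := by
        rw [Real.mul_rpow (by norm_num) hμ0.le, hsplit μ hμ0, hμq, ← mul_assoc,
          mul_inv_cancel₀ (by positivity), one_mul]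
      have e3 : (B * ε) ^ q = ε * μ := by
        rw [Real.mul_rpow hB.le hε0.le, hsplit ε hε0, hεq]
        have : B ^ q ≠ 0 := by positivity
        field_simp
      rw [e1, Real.mul_rpow (by positivity) (by positivity), ← Real.rpow_pow_comm (by positivity),
        e2, e3, pow_succ]
      ring
  refine tendsto_of_tendsto_of_tendsto_of_le_of_le tendsto_const_nhds ?_ ha0 key
  simpa using (tendsto_pow_atTop_nhds_zero_of_lt_one hμ0.le hμ1).const_mul ε

/-! ### Potential gaps and closeness to the well `-1`. -/

/-- The level `κ ∈ (0, 1)` below which `W` near the well `-1` lies under its values on the other side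
of the barrier. -/
theorem exists_level {m lam h : ℝ} (hm : 0 < m) (hlam : 0 < lam) (hh : 0 < h) :
    ∃ κ : ℝ, 0 < κ ∧ κ < 1 ∧ lam * (2 * κ) ^ m ≤ lam⁻¹ * h ^ m / 2 := by
  have hc : Tendsto (fun κ : ℝ => lam * (2 * κ) ^ m) (𝓝[>] 0) (𝓝 (lam * (2 * 0) ^ m)) := by
    refine Tendsto.mono_left ?_ nhdsWithin_le_nhds
    refine ContinuousAt.tendsto (f := fun κ : ℝ => lam * (2 * κ) ^ m) ?_
    exact continuousAt_const.mul ((continuousAt_const.mul continuousAt_id).rpow_const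
      (Or.inr hm.le))
  rw [mul_zero, Real.zero_rpow hm.ne', mul_zero] at hc
  have hpos : 0 < lam⁻¹ * h ^ m / 2 := by positivity
  obtain ⟨κ, h1, h2⟩ := ((hc.eventually (ge_mem_nhds hpos)).and
    (Ioo_mem_nhdsGT (zero_lt_one (α := ℝ)))).exists
  exact ⟨κ, h2.1, h2.2, h1⟩

/-- Since `1 - l ^ 2 ≤ 2 κ` near `-1` and `1 - τ ^ 2 ≥ h` on `(0, 1 - h]`, the choice of `κ` leaves
half of the lower bound for `W τ` as the gap. One gap serves all levels of the De Giorgi iteration.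
-/
theorem AssumptionB.gap_of_pos {n : ℕ} {m lam h κ : ℝ} {W : ℝ → EuclideanSpace ℝ (Fin n) → ℝ}
    (hB : AssumptionB m lam W) (hm : 0 < m) (hlam : 0 < lam) (hh : 0 < h) (hκ1 : κ < 1)
    (hκ : lam * (2 * κ) ^ m ≤ lam⁻¹ * h ^ m / 2) {l : ℝ} (hl : -1 ≤ l) (hlκ : l ≤ -1 + κ)
    (x : EuclideanSpace ℝ (Fin n)) {τ : ℝ} (hτ : 0 < τ) (hτh : τ ≤ 1 - h) :
    W l x + lam⁻¹ * h ^ m / 2 ≤ W τ x := by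
  have h1 : W l x ≤ lam * (2 * κ) ^ m := by
    refine (hB l x ⟨hl, by linarith⟩).2.trans (mul_le_mul_of_nonneg_left ?_ hlam.le)
    exact Real.rpow_le_rpow (by nlinarith) (by nlinarith) hm.le
  have h2 : lam⁻¹ * h ^ m ≤ W τ x := by
    refine le_trans (mul_le_mul_of_nonneg_left ?_ (inv_nonneg.mpr hlam.le))
      (hB τ x ⟨by linarith, by linarith⟩).1
    exact Real.rpow_le_rpow hh.le (by nlinarith) hm.le
  linarith

/-- `W` vanishes at `-1`, so a gap is available already for `τ` slightly above `-1`, from the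
factors `1 - τ ≥ h` and `1 + τ > κ / 2`. It supplies the initial smallness of the iteration. -/
theorem AssumptionB.gap_of_neg_one {n : ℕ} {m lam h κ : ℝ} {W : ℝ → EuclideanSpace ℝ (Fin n) → ℝ}
    (hB : AssumptionB m lam W) (hm : 0 < m) (hlam : 0 < lam) (hh : 0 < h) (hκ : 0 < κ)
    (x : EuclideanSpace ℝ (Fin n)) {τ : ℝ} (hτ : -1 + κ / 2 < τ) (hτh : τ ≤ 1 - h) :
    W (-1) x + lam⁻¹ * (h * (κ / 2)) ^ m ≤ W τ x := by
  have h1 : W (-1) x ≤ 0 := by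
    refine (hB (-1) x ⟨le_rfl, by norm_num⟩).2.trans (le_of_eq ?_)
    norm_num [Real.zero_rpow hm.ne']
  have h2 : lam⁻¹ * (h * (κ / 2)) ^ m ≤ W τ x := by
    refine le_trans (mul_le_mul_of_nonneg_left ?_ (inv_nonneg.mpr hlam.le))
      (hB τ x ⟨by linarith, by linarith⟩).1
    exact Real.rpow_le_rpow (by positivity) (by nlinarith) hm.le
  linarith

theorem volume_real_ball {n : ℕ} (hn : 2 ≤ n) {r : ℝ} (hr : 0 ≤ r) :
    volume.real (Metric.ball (0 : EuclideanSpace ℝ (Fin n)) r)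
      = r ^ n * volume.real (Metric.ball (0 : EuclideanSpace ℝ (Fin n)) 1) := by
  have : Nonempty (Fin n) := ⟨⟨0, by omega⟩⟩
  have h := Measure.addHaar_ball (volume : Measure (EuclideanSpace ℝ (Fin n))) 0 hr
  rw [measureReal_def, h, ENNReal.toReal_mul, ENNReal.toReal_ofReal (by positivity),
    finrank_euclideanSpace_fin, measureReal_def]

/-- A minimizer that stays away from the well `1` in a large ball is close to the well `-1` in a
smaller concentric ball. -/
theorem exists_radius_forall_ae_le {n : ℕ} (hn : 2 ≤ n) {p m lam h : ℝ} (hp : 1 < p) (hm : 0 < m)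
    (hlam : 0 < lam) (hh : 0 < h) :
    ∃ R κ : ℝ, 0 < R ∧ κ < 1 ∧
      ∀ (F : EuclideanSpace ℝ (Fin n) → ℝ → EuclideanSpace ℝ (Fin n) → ℝ)
        (W : ℝ → EuclideanSpace ℝ (Fin n) → ℝ) (Ω : Set (EuclideanSpace ℝ (Fin n)))
        (u : EuclideanSpace ℝ (Fin n) → ℝ)
        (G : EuclideanSpace ℝ (Fin n) → EuclideanSpace ℝ (Fin n)),
        IsMeasurableMinimizer p F W Ω u G → AssumptionA p lam F → AssumptionB m lam W →
        AssumptionC W → Metric.ball 0 (3 * R) ⊆ Ω →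
        (∀ᵐ x ∂(volume.restrict (Metric.ball 0 (3 * R))), u x ≤ 1 - h) →
        ∀ᵐ x ∂(volume.restrict (Metric.ball 0 R)), u x ≤ -1 + κ := by
  obtain ⟨κ, hκ0, hκ1, hκ⟩ := exists_level hm hlam hh
  obtain ⟨C, hC0, hC⟩ := exists_volume_superlevel_le hn hp hlam
    (by positivity : 0 < lam⁻¹ * h ^ m / 2)
  obtain ⟨K, hK0, hK⟩ := exists_caccioppoli_const hp hlam
    (by positivity : 0 < lam⁻¹ * (h * (κ / 2)) ^ m)
  have hn1 : (1 : ℝ) < n := by exact_mod_cast hn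
  set q := (n : ℝ) / ((n : ℝ) - 1) with hq
  have hq1 : 1 < q := by
    rw [hq, one_lt_div (by linarith)]
    linarith
  obtain ⟨ε, hε0, hε⟩ := exists_pos_tendsto_zero_of_superlinear
    (by positivity : 0 < C * (8 / κ)) hq1
  set V₁ := volume.real (Metric.ball (0 : EuclideanSpace ℝ (Fin n)) 1) with hV₁
  have hV₁0 : 0 ≤ V₁ := measureReal_nonneg
  -- `C`, `K` and `ε` are fixed before `R`. The initial density is at most `K (5 / 2) ^ n V₁ (2 / R)
  -- ^ p`, and `R ≥ 2` allows `(2 / R) ^ p` to be replaced by `2 / R`.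
  obtain ⟨R, hR2, hRε⟩ : ∃ R : ℝ, 2 ≤ R ∧ K * ((5 / 2) ^ n * V₁) * (2 / R) ≤ ε := by
    refine ⟨max 2 (K * ((5 / 2) ^ n * V₁) * 2 / ε), le_max_left _ _, ?_⟩
    rw [← mul_div_assoc, div_le_iff₀ (by positivity), mul_comm ε, ← div_le_iff₀ hε0]
    exact le_max_right _ _
  have hR0 : 0 < R := by linarith
  refine ⟨R, κ, hR0, hκ1, fun F W Ω u G hmin hA hB hCc hΩ hub => ?_⟩
  -- Levels increase from `-1 + κ / 2` to `-1 + κ` and radii decrease from `2 R` to `R`. The product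
  -- of the two increments is `(κ R / 8) 4⁻ʲ`, the source of the factors `8 / κ` and `4 ^ j`.
  set l : ℕ → ℝ := fun j => -1 + κ * (1 - (1 / 2) ^ (j + 1)) with hl
  set r : ℕ → ℝ := fun j => R * (1 + (1 / 2) ^ j) with hr
  set a : ℕ → ℝ := fun j => volume.real (superlevel u (l j) (r j)) with ha
  have hhalf : ∀ j : ℕ, 0 < (1 / 2 : ℝ) ^ j ∧ (1 / 2 : ℝ) ^ j ≤ 1 := fun j =>
    ⟨by positivity, pow_le_one₀ (by norm_num) (by norm_num)⟩
  have hl1 : ∀ j, -1 ≤ l j ∧ l j ≤ -1 + κ := fun j => by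
    have := hhalf (j + 1)
    constructor <;> simp only [hl] <;> nlinarith
  have hdl : ∀ j, l (j + 1) - l j = κ / 4 * (1 / 2) ^ j := fun j => by
    simp only [hl]
    ring
  have hdr : ∀ j, r j - r (j + 1) = R / 2 * (1 / 2) ^ j := fun j => by
    simp only [hr]
    ring
  -- The exponent `n / (n - 1)` makes the estimate scale invariant: for the densities `a j / R ^ n`
  -- the recursion has a constant free of `R`.
  have hRn : (R ^ (n - 1)) ^ q = R ^ n := by
    rw [← Real.rpow_natCast, ← Real.rpow_mul hR0.le, Nat.cast_sub (by omega), Nat.cast_one, hq,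
      mul_div_cancel₀ _ (by linarith), Real.rpow_natCast]
  have hstep : ∀ j, a (j + 1) / R ^ n ≤ (C * (8 / κ) * 4 ^ j * (a j / R ^ n)) ^ q := by
    intro j
    have hj := hhalf j
    have hlt : l j < l (j + 1) := by
      have : 0 < l (j + 1) - l j := by rw [hdl]; positivity
      linarith
    have hrt : r (j + 1) < r j := by
      have : 0 < r j - r (j + 1) := by rw [hdr]; positivity
      linarith
    have h1 := hC m (3 * R) (l j) (l (j + 1)) (1 - h) (r (j + 1)) (r j) F W Ω u G hmin hA hB hCc
      hm.le hΩ (hl1 j).1 (by linarith [(hl1 j).2]) hlt hub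
      (fun x τ h1 h2 => hB.gap_of_pos hm hlam hh hκ1 hκ (hl1 j).1 (hl1 j).2 x h1 h2)
      (mul_pos hR0 (by positivity)) hrt (by simp only [hr]; nlinarith)
    rw [hdl, hdr] at h1
    have haj : 0 ≤ a j := measureReal_nonneg
    rw [div_le_iff₀ (by positivity)]
    have e : C * (8 / κ) * 4 ^ j * (a j / R ^ n) * R ^ (n - 1)
        = C * (a j / (R / 2 * (1 / 2) ^ j * (κ / 4 * (1 / 2) ^ j))) := by
      have e1 : R ^ n = R ^ (n - 1) * R := by
        rw [← pow_succ, Nat.sub_add_cancel (by omega)]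
      have e2 : (4 : ℝ) ^ j = ((1 / 2) ^ j * (1 / 2) ^ j)⁻¹ := by
        rw [← mul_pow, ← inv_pow]
        norm_num
      rw [e1, e2]
      have := hj.1.ne'
      field_simp
      ring
    refine h1.trans (le_of_eq ?_)
    rw [← e, Real.mul_rpow (by positivity) (by positivity), hRn]
  have h0 : a 0 / R ^ n ≤ ε := by
    have hsub : superlevel u (l 0) (r 0) = superlevel u (-1) (2 * R) ∩ {x | -1 + κ / 2 < u x} := by
      have e1 : l 0 = -1 + κ / 2 := by simp only [hl]; ring
      have e2 : r 0 = 2 * R := by simp only [hr]; ring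
      ext x
      simp only [superlevel, mem_ofPred_eq, mem_inter_iff, e1, e2]
      refine ⟨fun hx => ⟨⟨hx.1, ?_⟩, hx.2⟩, fun hx => ⟨hx.1.1, hx.2⟩⟩
      linarith [hx.2]
    have hmes : MeasurableSet {x | -1 + κ / 2 < u x} :=
      measurableSet_lt measurable_const hmin.measurable
    have h1 := hK n m (3 * R) (-1) (-1 + κ / 2) (1 - h) (2 * R) (5 / 2 * R) F W Ω u G hmin hA hB hCc
      hm.le hΩ le_rfl (by linarith) (by linarith) hub
      (fun x τ h1 h2 => hB.gap_of_neg_one hm hlam hh hκ0 x h1 h2) (by linarith) (by linarith)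
      (by linarith)
    have ie := hmin.memW1pLoc.integrableOn_caccioppoliDensity (σ := -1 + κ / 2) (l := -1)
      (s := 2 * R) hmin.measurable hp hΩ (by linarith)
    -- The indicator part of the Caccioppoli density, with `σ = -1 + κ / 2`, measures exactly the
    -- first superlevel set.
    have h2 : a 0 ≤ ∫ x in superlevel u (-1) (2 * R),
        caccioppoliDensity p (-1 + κ / 2) u G x := by
      simp only [ha]
      rw [hsub, inter_comm, ← measureReal_restrict_apply hmes]
      have hfin : IsFiniteMeasure (volume.restrict (superlevel u (-1) (2 * R))) :=
        isFiniteMeasure_restrict.mpr (volume_superlevel_ne_top u _ _)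
      rw [← integral_indicator_one hmes]
      refine integral_mono ((integrable_indicator_iff hmes).mpr (integrable_const 1).integrableOn) ie
        fun x => ?_
      have : 0 ≤ ‖G x‖ ^ p := by positivity
      by_cases hx : -1 + κ / 2 < u x
      · rw [indicator_of_mem (show x ∈ {x | -1 + κ / 2 < u x} from hx), caccioppoliDensity,
          if_pos hx]
        simpa using this
      · rw [indicator_of_notMem (show x ∉ {x | -1 + κ / 2 < u x} from hx)]
        exact caccioppoliDensity_nonneg x
    have h3 : volume.real (superlevel u (-1) (5 / 2 * R)) ≤ (5 / 2) ^ n * V₁ * R ^ n := by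
      refine (measureReal_mono (superlevel_subset_ball u _ _) measure_ball_lt_top.ne).trans
        (le_of_eq ?_)
      rw [volume_real_ball hn (by positivity), mul_pow]
      ring
    have h4 : (5 / 2 * R - 2 * R)⁻¹ ^ p ≤ 2 / R := by
      have e : (5 / 2 * R - 2 * R)⁻¹ = 2 / R := by
        rw [show 5 / 2 * R - 2 * R = R / 2 by ring, inv_div]
      rw [e]
      have : 2 / R ≤ 1 := by rwa [div_le_one hR0]
      exact Real.rpow_le_self_of_le_one (by positivity) this hp.le
    rw [div_le_iff₀ (by positivity)]
    calc a 0 ≤ K * ((2 / R) * ((5 / 2) ^ n * V₁ * R ^ n)) := by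
          refine h2.trans (h1.trans ?_)
          gcongr
      _ = K * ((5 / 2) ^ n * V₁) * (2 / R) * R ^ n := by ring
      _ ≤ ε * R ^ n := by gcongr
  have hlim := hε (fun j => a j / R ^ n) (fun j => div_nonneg measureReal_nonneg (by positivity))
    hstep h0
  -- The limiting superlevel set lies in every set of the sequence, so its volume is at most the
  -- limit `0`.
  have hzero : volume.real (superlevel u (-1 + κ) R) = 0 := by
    refine le_antisymm ?_ measureReal_nonneg
    have hle : ∀ j, volume.real (superlevel u (-1 + κ) R) / R ^ n ≤ a j / R ^ n := fun j => by
      refine div_le_div_of_nonneg_right (measureReal_mono (superlevel_mono u (hl1 j).2 ?_)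
        (volume_superlevel_ne_top _ _ _)) (by positivity)
      simp only [hr]
      nlinarith [hhalf j]
    have := ge_of_tendsto' hlim hle
    rwa [div_le_iff₀ (by positivity), zero_mul] at this
  rw [measureReal_eq_zero_iff (volume_superlevel_ne_top _ _ _)] at hzero
  rw [ae_restrict_iff' measurableSet_ball, ae_iff]
  refine measure_mono_null (fun x hx => ?_) hzero
  simp only [mem_ofPred_eq, Classical.not_imp, not_le, mem_ball_zero_iff] at hx
  exact hx

/-! ### Representatives, precise values and the conclusion. -/

/-- Every minimizer has a measurable representative. -/
theorem IsMinimizer.exists_isMeasurableMinimizer {n : ℕ} {p : ℝ} (hp : 1 < p)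
    {F : EuclideanSpace ℝ (Fin n) → ℝ → EuclideanSpace ℝ (Fin n) → ℝ}
    {W : ℝ → EuclideanSpace ℝ (Fin n) → ℝ} {Ω : Set (EuclideanSpace ℝ (Fin n))}
    {u : EuclideanSpace ℝ (Fin n) → ℝ} (hΩ : IsOpen Ω) (h : IsMinimizer p F W Ω u) :
    ∃ u' G', IsMeasurableMinimizer p F W Ω u' G' ∧ u' =ᵐ[volume.restrict Ω] u := by
  obtain ⟨G, ⟨hW, huI⟩, hmin⟩ := h
  have hlu : AEStronglyMeasurable u (volume.restrict Ω) := by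
    refine LocallyIntegrableOn.aestronglyMeasurable (f := u) ?_
    rw [locallyIntegrableOn_iff hΩ.isLocallyClosed]
    exact fun K hKΩ hK => hW.integrableOn hp hK hKΩ
  have hlG : AEStronglyMeasurable G (volume.restrict Ω) := by
    refine LocallyIntegrableOn.aestronglyMeasurable (f := G) ?_
    rw [locallyIntegrableOn_iff hΩ.isLocallyClosed]
    exact fun K hKΩ hK => hW.integrableOn_gradient hp hK hKΩ
  -- Clamping changes nothing a.e. in `Ω` and makes the bounds hold at every point.
  set u' : EuclideanSpace ℝ (Fin n) → ℝ := fun x => max (-1) (min 1 (hlu.mk u x)) with hu'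
  set G' := hlG.mk G with hG'
  have eu : u' =ᵐ[volume.restrict Ω] u := by
    filter_upwards [hlu.ae_eq_mk, huI] with x hx hxI
    rw [hu']
    simp only
    rw [← hx, min_eq_right hxI.2, max_eq_right hxI.1]
  have eG : G' =ᵐ[volume.restrict Ω] G := hlG.ae_eq_mk.symm
  refine ⟨u', G', ⟨?_, hlG.stronglyMeasurable_mk.measurable, fun x => ?_,
    ⟨fun K hK hKΩ => ?_, fun K hK hKΩ => ?_, fun φ hφ hφc hφs => ?_⟩,
    fun D hD hDb hDΩ v H hv hvu => ?_⟩, eu⟩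
  · exact measurable_const.max (measurable_const.min hlu.stronglyMeasurable_mk.measurable)
  · exact ⟨le_max_left _ _, max_le (by norm_num) (min_le_left _ _)⟩
  · exact (memLp_congr_ae (ae_restrict_of_ae_restrict_of_subset hKΩ eu)).mpr (hW.memLp K hK hKΩ)
  · exact (memLp_congr_ae (ae_restrict_of_ae_restrict_of_subset hKΩ eG)).mpr
      (hW.memLp_gradient K hK hKΩ)
  · have := hW.isWeakGradient φ hφ hφc hφs
    rw [integral_congr_ae (g := fun x => u x • gradient φ x)
        (by filter_upwards [eu] with x hx; rw [hx]), this,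
      integral_congr_ae (f := fun x => φ x • G' x) (g := fun x => φ x • G x)
        (by filter_upwards [eG] with x hx; rw [hx])]
  · have hsub : D ⊆ Ω := subset_closure.trans hDΩ
    have he : energy F W u' G' D = energy F W u G D := by
      refine lintegral_congr_ae ?_
      filter_upwards [ae_restrict_of_ae_restrict_of_subset hsub eu,
        ae_restrict_of_ae_restrict_of_subset hsub eG] with x h1 h2
      rw [h1, h2]
    rw [he]
    refine hmin D hD hDb hDΩ v H hv ?_
    filter_upwards [ae_restrict_of_ae_restrict_of_subset sdiff_subset eu,
      ae_restrict_mem (hΩ.measurableSet.diff hD.measurableSet)] with x h1 h2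
    rw [hvu x h2.2, h1]

/-- Precise values average over open balls, the Besicovitch differentiation theorem over closed
ones. The dimension bound makes spheres null for every `r`, including `r = 0`. -/
theorem ball_ae_eq_closedBall {n : ℕ} (hn : 2 ≤ n) (x : EuclideanSpace ℝ (Fin n)) (r : ℝ) :
    Metric.ball x r =ᵐ[volume] Metric.closedBall x r := by
  have : Nontrivial (EuclideanSpace ℝ (Fin n)) :=
    Module.nontrivial_of_finrank_pos (R := ℝ) (by rw [finrank_euclideanSpace_fin]; omega)
  have hs := Measure.addHaar_sphere (volume : Measure (EuclideanSpace ℝ (Fin n))) x r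
  refine Metric.ball_subset_closedBall.eventuallyLE.antisymm ?_
  rw [ae_le_set, Metric.closedBall_sdiff_ball]
  exact hs

/-- Lebesgue's differentiation theorem in terms of precise values. -/
theorem ae_hasPreciseValue {n : ℕ} (hn : 2 ≤ n) {u : EuclideanSpace ℝ (Fin n) → ℝ}
    (hu : LocallyIntegrable u) : ∀ᵐ x, HasPreciseValue u x (u x) := by
  filter_upwards [(Besicovitch.vitaliFamily volume).ae_tendsto_average hu] with x hx
  refine (hx.comp (Besicovitch.tendsto_filterAt volume x)).congr fun r => ?_
  exact (setAverage_congr (ball_ae_eq_closedBall hn x r)).symm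

theorem HasPreciseValue.congr_ae {n : ℕ} {u v : EuclideanSpace ℝ (Fin n) → ℝ}
    {U : Set (EuclideanSpace ℝ (Fin n))} (hU : IsOpen U) (huv : u =ᵐ[volume.restrict U] v)
    {x : EuclideanSpace ℝ (Fin n)} (hx : x ∈ U) {c : ℝ} (h : HasPreciseValue u x c) :
    HasPreciseValue v x c := by
  obtain ⟨δ, hδ, hδU⟩ := Metric.isOpen_iff.mp hU x hx
  refine Tendsto.congr' ?_ h
  filter_upwards [Ioo_mem_nhdsGT hδ] with r hr
  exact average_congr (ae_restrict_of_ae_restrict_of_subset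
    ((Metric.ball_subset_ball hr.2.le).trans hδU) huv)

theorem HasPreciseValue.le_of_ae_le {n : ℕ} {u : EuclideanSpace ℝ (Fin n) → ℝ}
    (hu : LocallyIntegrable u) {x : EuclideanSpace ℝ (Fin n)} {R b c : ℝ} (hR : 0 < R)
    (hb : ∀ᵐ y ∂(volume.restrict (Metric.ball x R)), u y ≤ b) (h : HasPreciseValue u x c) :
    c ≤ b := by
  refine le_of_tendsto h ?_
  filter_upwards [Ioo_mem_nhdsGT hR] with r hr
  exact (convex_Iic b).set_average_mem isClosed_Iic (Metric.measure_ball_pos volume x hr.1).ne'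
    measure_ball_lt_top.ne
    (ae_restrict_of_ae_restrict_of_subset (Metric.ball_subset_ball hr.2.le) hb)
    ((hu.integrableOn_isCompact (isCompact_closedBall x r)).mono_set Metric.ball_subset_closedBall)

theorem lemma2p2 (n : ℕ) (hn : 2 ≤ n) (p m lam : ℝ)
    (hp : 1 < p) (hpn : p < (n : ℝ) / ((n : ℝ) - 1)) (hm : p < m) (hlam : 0 < lam)
    (h : ℝ) (h_pos : 0 < h) (h_lt : h < 1) :
    ∃ ρ : ℝ, 0 < ρ ∧
      ∀ (F : EuclideanSpace ℝ (Fin n) → ℝ → EuclideanSpace ℝ (Fin n) → ℝ)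
        (W : ℝ → EuclideanSpace ℝ (Fin n) → ℝ),
        AssumptionA p lam F → AssumptionB m lam W → AssumptionC W →
        ∀ (Ω : Set (EuclideanSpace ℝ (Fin n))) (u : EuclideanSpace ℝ (Fin n) → ℝ),
          IsOpen Ω → Metric.ball 0 ρ ⊆ Ω → IsMinimizer p F W Ω u → HasPreciseValue u 0 0 →
          ∃ x ∈ Metric.ball (0 : EuclideanSpace ℝ (Fin n)) ρ, ∃ c : ℝ,
            HasPreciseValue u x c ∧ 1 - h ≤ c := by

  obtain ⟨R, κ, hR, hκ, hmain⟩ := exists_radius_forall_ae_le hn hp (by linarith : 0 < m) hlam h_pos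
  refine ⟨3 * R, by linarith, fun F W hA hB hC Ω u hΩ hball hmin hu0 => ?_⟩
  by_contra! hcon
  obtain ⟨v, G, hv, hvu⟩ := hmin.exists_isMeasurableMinimizer hp hΩ
  have hloc : LocallyIntegrable v := by
    refine (locallyIntegrable_const (1 : ℝ)).mono hv.measurable.aestronglyMeasurable
      (Eventually.of_forall fun x => ?_)
    rw [norm_one]
    exact abs_le.mpr (hv.mem_Icc x)
  -- At a.e. point of the ball `v x` is a precise value of `v`, hence of `u`, so the negated
  -- conclusion bounds it by `1 - h`.
  have hle : ∀ᵐ x ∂(volume.restrict (Metric.ball 0 (3 * R))), v x ≤ 1 - h := by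
    filter_upwards [ae_restrict_of_ae (ae_hasPreciseValue hn hloc),
      ae_restrict_mem measurableSet_ball] with x hx hxb
    exact (hcon x hxb (v x) (hx.congr_ae hΩ hvu (hball hxb))).le
  have hsmall := hmain F W Ω v G hv hA hB hC hball hle
  -- The bound on the averages near the centre gives `0 ≤ -1 + κ`, contradicting `κ < 1`.
  have h0 : (0 : EuclideanSpace ℝ (Fin n)) ∈ Ω := hball (Metric.mem_ball_self (by linarith))
  have := (hu0.congr_ae hΩ hvu.symm h0).le_of_ae_le hloc hR hsmall
  linarith
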